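/- **Setting.** Let $SE(2)=\mathbb R^2\rtimes SO(2)$ with elements $g=(\mathbf x,\mathbf R_\theta)$, product $(\mathbf x,\mathbf R)(\mathbf x',\mathbf R')=(\mathbf x+\mathbf R\mathbf x',\mathbf R\mathbf R')$, and Haar measure $dg=c\,dx_1dx_2d\theta$ ($\theta\in(0,2\pi]$), where $c>0$ is any fixed normalization. Write $g(a,\phi,\theta)=((a\cos\phi,a\sin\phi),\mathbf R_\theta)$. Let $\Gamma=\mathbb Z^2\subset SE(2)$ be the subgroup of integral translations, let $\widetilde f(\Gamma g)=\sum_{\gamma\in\Gamma}f(\gamma g)$ be the periodization of $f$, and let $\mu$ be the finite $SE(2)$-invariant measure on the right coset space $\Gamma\backslash SE(2)$ normalized by Weil's formula $\int\widetilde f\,d\mu=\int f\,dg$ for $f\in L^1(SE(2))$. For $k\in\mathbb Z^3$ let $\psi_k(\Gamma g)=e^{2\pi i(k_1x_1+k_2x_2)}e^{ik_3\theta}$ for $g=((x_1,x_2),\mathbf R_\theta)$. For $f\in L^1(SE(2))$ and $k\in\mathbb Z$ put $\widehat f[k]=\int f(g)e^{-ik\theta}\,dg$. Fix a sign $\varepsilon\in\{1,-1\}$.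 For $p>0$ let $[U_p(\mathbf t,\mathbf R)v](\mathbf u)=e^{\varepsilon ip\langle\mathbf u,\mathbf t\rangle}v(\mathbf R^{-1}\mathbf u)$ on $L^2(\mathbb S^1)$ (normalized arc length, inner product linear in the first entry), $\widehat f(p)=\int f(g)U_p(g^{-1})\,dg$ (strong operator integral) and $\widehat f(p)_{nm}=\langle\widehat f(p)\mathbf e_n,\mathbf e_m\rangle$, where $\mathbf e_k(\cos\alpha,\sin\alpha)=e^{ik\alpha}$. For $(k_1,k_2)\in\mathbb Z^2\setminus\{0\}$ let $\rho(k_1,k_2)=\sqrt{k_1^2+k_2^2}$ and let $\Phi(k_1,k_2)\in[0,2\pi)$ be the polar angle of $(k_1,k_2)$. **Theorem.** Let $f\in L^1(SE(2))$ with $\widetilde{|f|}\in L^2(\Gamma\backslash SE(2),\mu)$. Then $\widetilde f\in L^2(\Gamma\backslash SE(2),\mu)$ and $$2\pi c\,\widetilde f(\Gamma h)=\sum_{k\in\mathbb Z}\widehat f[k]e^{ik\alpha}+\sum_{(k_1,k_2)\ne0}\sum_{k_3\in\mathbb Z}\sum_{n\in\mathbb Z}e^{i(k_3-n)\Phi(k_1,k_2)}\,\widehat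 f(2\pi\rho(k_1,k_2))_{nk_3}\,e^{2\pi i\varepsilon a(k_1\cos\phi+k_2\sin\phi)}e^{-ik_3\alpha},\qquad h=g(a,\phi,\alpha),$$ as an identity in $L^2(\Gamma\backslash SE(2),\mu)$. Here each inner series over $n\in\mathbb Z$ of the scalars $e^{i(k_3-n)\Phi(k_1,k_2)}\widehat f(2\pi\rho(k_1,k_2))_{nk_3}$ converges, as the limit of $\sum_{n=-M}^{N}$ when $M,N\to\infty$ independently; the series over $k$, and the series over all $((k_1,k_2),k_3)$ with $(k_1,k_2)\ne0$, converge unconditionally in $L^2(\Gamma\backslash SE(2),\mu)$. In particular, for $c=1/(2\pi)$ (for which $(\psi_k)_{k\in\mathbb Z^3}$ is an orthonormal basis of $L^2(\Gamma\backslash SE(2),\mu)$) and $\varepsilon=1$, the right-hand side equals $\widetilde f(\Gamma h)$ itself. -/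

import Mathlib

open MeasureTheory
open scoped ComplexConjugate ENNReal Real

noncomputable section

namespace SE2Fourier

instance factTwoPiPos : Fact (0 < 2 * π) := ⟨Real.two_pi_pos⟩

/-- The circle of angles `ℝ / 2πℤ`. An angle `θ` stands both for the rotation `R_θ ∈ SO(2)` and for
the point `u_θ = (cos θ, sin θ)` of the unit circle `𝕊¹`. -/
abbrev Angle : Type := AddCircle (2 * π)

/-- The point `u_θ = (cos θ, sin θ)` of the unit circle, as the complex number `e^{iθ}`. -/
def unitVec (θ : Angle) : ℂ := (AddCircle.toCircle θ : ℂ)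

/-- The group `SE(2) = ℝ² ⋊ SO(2)`. The plane `ℝ²` is identified with `ℂ` and a rotation `R_θ` is
recorded by its angle, so that `R_θ x` is the product `e^{iθ} x`. -/
@[ext]
structure SE2 : Type where
  /-- the translation part `x ∈ ℝ²` -/
  trans : ℂ
  /-- the angle of the rotation part -/
  ang : Angle

namespace SE2

instance : Mul SE2 := ⟨fun g h => ⟨g.trans + unitVec g.ang * h.trans, g.ang + h.ang⟩⟩

instance : One SE2 := ⟨⟨0, 0⟩⟩

instance : Inv SE2 := ⟨fun g => ⟨-(unitVec (-g.ang) * g.trans), -g.ang⟩⟩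

@[simp] theorem mul_trans (g h : SE2) : (g * h).trans = g.trans + unitVec g.ang * h.trans := rfl
@[simp] theorem mul_ang (g h : SE2) : (g * h).ang = g.ang + h.ang := rfl
@[simp] theorem one_trans : (1 : SE2).trans = 0 := rfl
@[simp] theorem one_ang : (1 : SE2).ang = 0 := rfl
@[simp] theorem inv_trans (g : SE2) : (g⁻¹).trans = -(unitVec (-g.ang) * g.trans) := rfl
@[simp] theorem inv_ang (g : SE2) : (g⁻¹).ang = -g.ang := rfl

theorem unitVec_zero : unitVec 0 = 1 := by simp [unitVec]

theorem unitVec_add (a b : Angle) : unitVec (a + b) = unitVec a * unitVec b := by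
  simp [unitVec, AddCircle.toCircle_add]

theorem unitVec_coe (θ : ℝ) :
    unitVec (θ : Angle) = ((Real.cos θ : ℝ) : ℂ) + ((Real.sin θ : ℝ) : ℂ) * Complex.I := by
  have h : 2 * π / (2 * π) * θ = θ := by field_simp
  rw [unitVec, AddCircle.toCircle_apply_mk, h, Circle.coe_exp, Complex.exp_mul_I]
  push_cast
  rfl

instance : Group SE2 :=
  Group.ofLeftAxioms
    (fun a b c => by
      ext
      · simp [unitVec_add]; ring
      · simp [add_assoc])
    (fun a => by ext <;> simp [unitVec_zero])
    (fun a => by ext <;> simp)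

/-- The Borel σ-algebra of `ℝ² × ℝ/2πℤ`, transported to `SE(2)`. -/
instance : MeasurableSpace SE2 := MeasurableSpace.comap (fun g => (g.trans, g.ang)) inferInstance

/-- The element `g(a, φ, θ)`: translation by `(a cos φ, a sin φ)`, rotation by `θ`. -/
def polar (a φ θ : ℝ) : SE2 := ⟨⟨a * Real.cos φ, a * Real.sin φ⟩, (θ : Angle)⟩

/-- The `3 × 3` matrix of an element of `SE(2)`. -/
def toMatrix (g : SE2) : Matrix (Fin 3) (Fin 3) ℝ :=
  !![(unitVec g.ang).re, -(unitVec g.ang).im, g.trans.re;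
     (unitVec g.ang).im, (unitVec g.ang).re, g.trans.im;
     0, 0, 1]

theorem toMatrix_polar (a φ θ : ℝ) :
    (polar a φ θ).toMatrix =
      !![Real.cos θ, -Real.sin θ, a * Real.cos φ;
         Real.sin θ, Real.cos θ, a * Real.sin φ;
         0, 0, 1] := by
  simp [toMatrix, polar, unitVec_coe, -Complex.ofReal_cos, -Complex.ofReal_sin]

theorem toMatrix_mul (g h : SE2) : (g * h).toMatrix = g.toMatrix * h.toMatrix := by
  ext i j
  fin_cases i <;> fin_cases j <;>
    simp [toMatrix, Matrix.mul_apply, Fin.sum_univ_three, unitVec_add] <;> ring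

end SE2

/-- The Haar measure `dg = c dx₁ dx₂ dθ` of `SE(2)`; here `dθ` has total mass `2π`. -/
def haar (c : ℝ) : Measure SE2 :=
  ENNReal.ofReal c •
    Measure.map (fun q : ℂ × Angle => (⟨q.1, q.2⟩ : SE2))
      ((volume : Measure ℂ).prod (volume : Measure Angle))

/-- The lattice `Γ = ℤ²`, as the subgroup of integral translations. -/
def lattice : Subgroup SE2 where
  carrier := {g | g.ang = 0 ∧ ∃ m n : ℤ, g.trans = ⟨m, n⟩}
  one_mem' := ⟨rfl, 0, 0, by simp [Complex.ext_iff]⟩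
  mul_mem' := by
    rintro g h ⟨hg, m, n, hmn⟩ ⟨hh, m', n', hmn'⟩
    refine ⟨by simp [hg, hh], m + m', n + n', ?_⟩
    rw [SE2.mul_trans, hg, SE2.unitVec_zero, hmn, hmn']
    simp [Complex.ext_iff]
  inv_mem' := by
    rintro g ⟨hg, m, n, hmn⟩
    refine ⟨by simp [hg], -m, -n, ?_⟩
    rw [SE2.inv_trans, hg, neg_zero, SE2.unitVec_zero, hmn]
    simp [Complex.ext_iff]

/-- The right coset space `Γ \ SE(2) = {Γ g}`: the orbits of the left multiplication by `Γ`. -/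
abbrev CosetSpace : Type := Quotient (MulAction.orbitRel lattice SE2)

/-- The coset `Γ g`. -/
def coset (g : SE2) : CosetSpace := Quotient.mk (MulAction.orbitRel lattice SE2) g

/-- The periodization `f̃(Γ g) = ∑_{γ ∈ Γ} f(γ g)`. -/
def periodize {M : Type*} [TopologicalSpace M] [AddCommMonoid M] [T2Space M]
    (f : SE2 → M) : CosetSpace → M :=
  MulAction.automorphize f

/-- The right action `Γ g ↦ Γ g h` of `h ∈ SE(2)` on the coset space. -/
def rightTranslate (h : SE2) : CosetSpace → CosetSpace :=
  Quotient.map (fun g => g * h) (by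
    rintro a b ⟨γ, rfl⟩
    exact ⟨γ, by simp [Subgroup.smul_def, mul_assoc]⟩)

/-- `μ` is the `SE(2)`-invariant measure on `Γ \ SE(2)`, normalized by Weil's formula with respect
to the Haar measure `dg = c dx₁ dx₂ dθ`. -/
structure IsNormalizedInvariant (c : ℝ) (μ : Measure CosetSpace) : Prop where
  invariant : ∀ (h : SE2) (E : Set CosetSpace), MeasurableSet E → μ (rightTranslate h '' E) = μ E
  weil : ∀ f : SE2 → ℂ, Integrable f (haar c) → ∫ q, periodize f q ∂μ = ∫ g, f g ∂(haar c)

/-- The one-dimensional representation `χ_n(g) = e^{inθ}`. -/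
def chi (n : ℤ) (g : SE2) : ℂ := fourier n g.ang

/-- `f̂[n] = ∫ f(g) conj(χ_n(g)) dg`. -/
def charCoeff (c : ℝ) (f : SE2 → ℂ) (n : ℤ) : ℂ := ∫ g, f g * conj (chi n g) ∂(haar c)

/-- `L²(𝕊¹)` for the normalized measure `dα / 2π`. -/
abbrev L2Circle : Type := Lp ℂ 2 (AddCircle.haarAddCircle (T := 2 * π))

/-- The factor `e^{ε i p ⟨u_α, x⟩}`, where `ε` is a sign. -/
def phase (ε : ℤˣ) (p : ℝ) (x : ℂ) (α : Angle) : ℂ :=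
  Complex.exp (Complex.I * (((ε : ℤ) : ℝ) * p * ((unitVec α).re * x.re + (unitVec α).im * x.im) : ℝ))

theorem continuous_phase (ε : ℤˣ) (p : ℝ) (x : ℂ) : Continuous (phase ε p x) := by
  have h : Continuous unitVec := continuous_subtype_val.comp AddCircle.continuous_toCircle
  have h1 : Continuous fun α => (unitVec α).re := Complex.continuous_re.comp h
  have h2 : Continuous fun α => (unitVec α).im := Complex.continuous_im.comp h
  unfold phase
  fun_prop

theorem norm_phase (ε : ℤˣ) (p : ℝ) (x : ℂ) (α : Angle) : ‖phase ε p x α‖ = 1 := by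
  rw [phase, mul_comm, Complex.norm_exp_ofReal_mul_I]

theorem memLp_repr (ε : ℤˣ) (p : ℝ) (g : SE2) (v : L2Circle) :
    MemLp (fun α : Angle => phase ε p g.trans α * v (α - g.ang)) 2
      (AddCircle.haarAddCircle (T := 2 * π)) := by
  have h : MemLp (fun α : Angle => v (α - g.ang)) 2 (AddCircle.haarAddCircle (T := 2 * π)) :=
    (Lp.memLp v).comp_measurePreserving
      (measurePreserving_sub_right (AddCircle.haarAddCircle (T := 2 * π)) g.ang)
  refine h.of_le ((continuous_phase ε p g.trans).aestronglyMeasurable.mul h.1) ?_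
  exact Filter.Eventually.of_forall fun α => by rw [norm_mul, norm_phase, one_mul]

/-- The representation `U_p` of `SE(2)` on `L²(𝕊¹)`:
`[U_p(x, R_θ) v](u) = e^{ε i p ⟨u, x⟩} v(R_θ⁻¹ u)`, where the sign `ε` is a convention. -/
def repr (ε : ℤˣ) (p : ℝ) (g : SE2) (v : L2Circle) : L2Circle := (memLp_repr ε p g v).toLp _

/-- The operator-valued Fourier transform `f̂(p) = ∫ f(g) U_p(g⁻¹) dg` on `L²(𝕊¹)`, a strong
operator integral: it is evaluated vector by vector. -/
def opFourier (ε : ℤˣ) (c : ℝ) (f : SE2 → ℂ) (p : ℝ) (v : L2Circle) : L2Circle :=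
  ∫ g, f g • repr ε p g⁻¹ v ∂(haar c)

/-- The matrix element `f̂(p)_{nm} = ⟨f̂(p) e_n, e_m⟩` for `e_k(u_α) = e^{ikα}`; the pairing is
linear in the first entry and conjugate linear in the second. -/
def opEntry (ε : ℤˣ) (c : ℝ) (f : SE2 → ℂ) (p : ℝ) (n m : ℤ) : ℂ :=
  inner ℂ (fourierLp (T := 2 * π) 2 m) (opFourier ε c f p (fourierLp (T := 2 * π) 2 n))

/-- `ρ(k₁, k₂) = √(k₁² + k₂²)`. -/
def rho (κ : ℤ × ℤ) : ℝ := √((κ.1 : ℝ) ^ 2 + (κ.2 : ℝ) ^ 2)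

/-- The polar angle `Φ(k₁, k₂) ∈ [0, 2π)`. -/
def Phi (κ : ℤ × ℤ) : ℝ :=
  toIcoMod Real.two_pi_pos 0 (Complex.arg (⟨(κ.1 : ℝ), (κ.2 : ℝ)⟩ : ℂ))

theorem Phi_mem (κ : ℤ × ℤ) : Phi κ ∈ Set.Ico 0 (2 * π) := by
  simpa [Phi] using toIcoMod_mem_Ico Real.two_pi_pos 0 (Complex.arg (⟨(κ.1 : ℝ), (κ.2 : ℝ)⟩ : ℂ))

theorem rho_mul_cos_Phi (κ : ℤ × ℤ) : rho κ * Real.cos (Phi κ) = κ.1 := by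
  have h := Complex.norm_mul_cos_arg (⟨(κ.1 : ℝ), (κ.2 : ℝ)⟩ : ℂ)
  have h1 : Real.cos (Phi κ) = Real.cos (Complex.arg (⟨(κ.1 : ℝ), (κ.2 : ℝ)⟩ : ℂ)) := by
    rw [Phi, toIcoMod, zsmul_eq_mul, Real.cos_sub_int_mul_two_pi]
  rw [Complex.norm_def, Complex.normSq_mk, ← sq, ← sq] at h
  rw [h1, rho]
  exact_mod_cast h

theorem rho_mul_sin_Phi (κ : ℤ × ℤ) : rho κ * Real.sin (Phi κ) = κ.2 := by
  have h := Complex.norm_mul_sin_arg (⟨(κ.1 : ℝ), (κ.2 : ℝ)⟩ : ℂ)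
  have h1 : Real.sin (Phi κ) = Real.sin (Complex.arg (⟨(κ.1 : ℝ), (κ.2 : ℝ)⟩ : ℂ)) := by
    rw [Phi, toIcoMod, zsmul_eq_mul, Real.sin_sub_int_mul_two_pi]
  rw [Complex.norm_def, Complex.normSq_mk, ← sq, ← sq] at h
  rw [h1, rho]
  exact_mod_cast h

/-- The function `e^{2πi(k₁x + k₂y)} e^{ik₃θ}` on `SE(2)`. -/
def basisLift (k₁ k₂ k₃ : ℤ) (g : SE2) : ℂ :=
  Complex.exp (2 * π * Complex.I * (k₁ * g.trans.re + k₂ * g.trans.im)) * fourier k₃ g.ang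

theorem basisLift_smul (k₁ k₂ k₃ : ℤ) (γ : lattice) (g : SE2) :
    basisLift k₁ k₂ k₃ (γ • g) = basisLift k₁ k₂ k₃ g := by
  obtain ⟨γ, hγ, m, n, hmn⟩ := γ
  have h1 : ((⟨γ, hγ, m, n, hmn⟩ : lattice) • g : SE2) = γ * g := rfl
  have h2 : (γ * g).trans = ⟨m + g.trans.re, n + g.trans.im⟩ := by
    rw [SE2.mul_trans, hγ, SE2.unitVec_zero, hmn]
    simp [Complex.ext_iff]
  have h3 : (γ * g).ang = g.ang := by rw [SE2.mul_ang, hγ, zero_add]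
  rw [h1, basisLift, basisLift, h2, h3]
  congr 1
  rw [Complex.exp_eq_exp_iff_exists_int]
  refine ⟨k₁ * m + k₂ * n, ?_⟩
  push_cast
  ring

/-- The basis function `ψ_k(Γ g(x, y, θ)) = e^{2πi(k₁x + k₂y)} e^{ik₃θ}` on `Γ \ SE(2)`. -/
def psi (k₁ k₂ k₃ : ℤ) : CosetSpace → ℂ :=
  Quotient.lift (basisLift k₁ k₂ k₃) (by
    rintro a b ⟨γ, rfl⟩
    exact basisLift_smul k₁ k₂ k₃ γ b)

/-- The value of `ψ_k` at `Γ h`, for `h = g(a, φ, α)`. -/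
theorem psi_polar (k₁ k₂ k₃ : ℤ) (a φ α : ℝ) :
    psi k₁ k₂ k₃ (coset (SE2.polar a φ α)) =
      Complex.exp (2 * π * Complex.I * a * (k₁ * Real.cos φ + k₂ * Real.sin φ)) *
        Complex.exp (Complex.I * k₃ * α) := by
  change basisLift k₁ k₂ k₃ (SE2.polar a φ α) = _
  rw [basisLift, SE2.polar, fourier_coe_apply]
  congr 2
  · push_cast
    ring
  · push_cast
    have : (π : ℂ) ≠ 0 := by exact_mod_cast Real.pi_ne_zero
    field_simp

theorem measurable_psi (k₁ k₂ k₃ : ℤ) : Measurable (psi k₁ k₂ k₃) := by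
  rw [measurable_from_quotient]
  change Measurable (basisLift k₁ k₂ k₃)
  have h0 : Measurable fun g : SE2 => (g.trans, g.ang) := comap_measurable _
  have h1 : Measurable fun g : SE2 => g.trans := measurable_fst.comp h0
  have h2 : Measurable fun g : SE2 => g.ang := measurable_snd.comp h0
  have h3 : Measurable fun g : SE2 => g.trans.re := Complex.measurable_re.comp h1
  have h4 : Measurable fun g : SE2 => g.trans.im := Complex.measurable_im.comp h1
  have h5 : Measurable fun g : SE2 => fourier k₃ g.ang :=
    (fourier k₃).continuous.measurable.comp h2
  unfold basisLift
  fun_prop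

theorem norm_psi (k₁ k₂ k₃ : ℤ) (q : CosetSpace) : ‖psi k₁ k₂ k₃ q‖ = 1 := by
  induction q using Quotient.inductionOn with
  | h g =>
    change ‖basisLift k₁ k₂ k₃ g‖ = 1
    have h : 2 * (π : ℂ) * Complex.I * (k₁ * g.trans.re + k₂ * g.trans.im) =
        ((2 * π * (k₁ * g.trans.re + k₂ * g.trans.im) : ℝ) : ℂ) * Complex.I := by
      push_cast
      ring
    rw [basisLift, norm_mul, h, Complex.norm_exp_ofReal_mul_I, fourier_apply, Circle.norm_coe,
      one_mul]

theorem memLp_psi (μ : Measure CosetSpace) [IsFiniteMeasure μ] (k₁ k₂ k₃ : ℤ) :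
    MemLp (psi k₁ k₂ k₃) 2 μ :=
  MemLp.of_bound (measurable_psi k₁ k₂ k₃).aestronglyMeasurable 1
    (Filter.Eventually.of_forall fun q => (norm_psi k₁ k₂ k₃ q).le)

/-- `ψ_k` as an element of `L²(Γ \ SE(2), μ)`. -/
def psiLp (μ : Measure CosetSpace) [IsFiniteMeasure μ] (k₁ k₂ k₃ : ℤ) : Lp ℂ 2 μ :=
  (memLp_psi μ k₁ k₂ k₃).toLp _

/-- The `n`-th term `e^{i(k₃ - n)Φ(κ)} f̂(2πρ(κ))_{n k₃}` of the inner series. -/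
def innerTerm (ε : ℤˣ) (c : ℝ) (f : SE2 → ℂ) (κ : ℤ × ℤ) (k₃ n : ℤ) : ℂ :=
  Complex.exp (Complex.I * ((k₃ : ℂ) - n) * Phi κ) * opEntry ε c f (2 * π * rho κ) n k₃

end SE2Fourier

end

open SE2Fourier

/-! The functions `psi` pull back to the Fourier basis of a three-dimensional torus, so they form a
complete orthogonal system in which each has norm squared `2πc`. Weil's formula turns the inner
product of the periodization with `psi` into the integral of `f` against the conjugate of
`basisLift`. This gives an unconditional expansion of `2πc` times the periodization. The zero planar
frequencies yield `charCoeff`, and it remains to identify the other coefficients with the inner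
series.

The matrix entry `(n, m)` of the operator transform is the integral of `f(g) e^{imθ} c_{m-n}(x)`,
where `c_j(x)` is the `j`-th Fourier coefficient on the circle of the plane wave `phase ε p (-x)`.
With the weights `e^{i(m-n)Φ}`, the sum over `n` is the Fourier series of that wave at the angle
`Φ`. Its sum there is the required character, because `2πρ u_Φ = 2π(k₁, k₂)`.

The difficulty is to exchange the sum with the integral. The function `f` is only integrable, and
the `ℓ¹` norm of `c_j(x)` is not bounded in `x`. Dominated convergence works because the partial
sums over intervals of integers are bounded uniformly in `x` (`norm_sum_fourierCoeff_phase_le`).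
Such a partial sum is an integral of a Dirichlet kernel against `e^{ir cos(β-s)}`, and after folding
`s` with `-s` it becomes a singular integral with amplitude `1/(2 sin(s/2))` and phase `r cos(β-s) +
Ls`. The phase is replaced near `0` by its quadratic, then linear, then constant Taylor polynomial,
at the scales where cubic, quadratic and linear terms become of size one. Beyond each scale van der
Corput's lemma supplies the cancellation (`exists_integral_amp_sub_le`), so no bound depends on `r`,
`β` or `L`. -/

namespace Oscillatory

/-! ### Van der Corput estimates with first, second and third derivatives. -/

open Set intervalIntegral

/-- The phase factor `e^{iφ(s)}`. -/
noncomputable def cis (φ : ℝ → ℝ) (s : ℝ) : ℂ := Complex.exp ((φ s : ℂ) * Complex.I)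

theorem norm_cis (φ : ℝ → ℝ) (s : ℝ) : ‖cis φ s‖ = 1 := Complex.norm_exp_ofReal_mul_I _

theorem continuous_cis {φ : ℝ → ℝ} (h : Continuous φ) : Continuous (cis φ) := by
  unfold cis; fun_prop

theorem hasDerivAt_cis {φ : ℝ → ℝ} {d s : ℝ} (h : HasDerivAt φ d s) :
    HasDerivAt (cis φ) (Complex.I * d * cis φ s) s := by
  have := ((h.ofReal_comp).mul_const Complex.I).cexp
  refine HasDerivAt.congr_deriv (f := cis φ) this ?_
  change Complex.exp _ * _ = _ * Complex.exp _
  ring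

theorem norm_cis_sub_cis_le (φ χ : ℝ → ℝ) (s t : ℝ) : ‖cis φ s - cis χ t‖ ≤ |φ s - χ t| := by
  have h : cis φ s - cis χ t = cis χ t * (Complex.exp (Complex.I * ((φ s - χ t : ℝ) : ℂ)) - 1) := by
    rw [mul_sub, cis, cis, ← Complex.exp_add]
    push_cast
    ring_nf
  rw [h, norm_mul, norm_cis, one_mul]
  exact Real.norm_exp_I_mul_ofReal_sub_one_le

theorem norm_integral_cis_le (φ : ℝ → ℝ) {a b : ℝ} (hab : a ≤ b) :
    ‖∫ s in a..b, cis φ s‖ ≤ b - a := by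
  have := norm_integral_le_of_norm_le_const (a := a) (b := b) (f := cis φ) (C := 1)
    fun s _ => (norm_cis φ s).le
  rwa [one_mul, abs_of_nonneg (sub_nonneg.2 hab)] at this

/-- Integration against a decreasing amplitude. -/
theorem norm_integral_mul_le {g : ℝ → ℂ} (hg : Continuous g) {w w' : ℝ → ℝ} {a b K : ℝ}
    (hab : a ≤ b) (hw : ∀ s ∈ Icc a b, HasDerivAt w (w' s) s) (hw' : ContinuousOn w' (Icc a b))
    (hneg : ∀ s ∈ Icc a b, w' s ≤ 0) (hwb : 0 ≤ w b)
    (hK : ∀ s ∈ Icc a b, ‖∫ t in a..s, g t‖ ≤ K) :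
    ‖∫ s in a..b, (w s : ℂ) * g s‖ ≤ K * w a := by
  have hu : uIcc a b = Icc a b := uIcc_of_le hab
  have hi : IntervalIntegrable w' volume a b := by
    apply ContinuousOn.intervalIntegrable; rwa [hu]
  have hic : IntervalIntegrable (fun s => (w' s : ℂ)) volume a b := by
    apply ContinuousOn.intervalIntegrable; rw [hu]
    exact Complex.continuous_ofReal.comp_continuousOn hw'
  have hG : ∀ s, HasDerivAt (fun s => ∫ t in a..s, g t) (g s) s := fun s =>
    integral_hasDerivAt_right (hg.intervalIntegrable _ _)
      hg.aestronglyMeasurable.stronglyMeasurableAtFilter hg.continuousAt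
  rw [integral_mul_deriv_eq_deriv_mul (u := fun s => (w s : ℂ)) (v := fun s => ∫ t in a..s, g t)
    (u' := fun s => (w' s : ℂ)) (fun s hs => (hw s (hu ▸ hs)).ofReal_comp) (fun s _ => hG s) hic
    (hg.intervalIntegrable _ _)]
  have h1 : ‖∫ s in a..b, (w' s : ℂ) * ∫ t in a..s, g t‖ ≤ ∫ s in a..b, -w' s * K := by
    apply norm_integral_le_of_norm_le hab
    · refine Filter.Eventually.of_forall fun s hs => ?_
      have hs' : s ∈ Icc a b := Ioc_subset_Icc_self hs
      rw [norm_mul, Complex.norm_real, Real.norm_eq_abs, abs_of_nonpos (hneg s hs')]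
      exact mul_le_mul_of_nonneg_left (hK s hs') (neg_nonneg.2 (hneg s hs'))
    · exact hi.neg.mul_const K
  -- The integral of `-w'` is `w a - w b`; the boundary term at `b` restores `K * w b`.
  rw [intervalIntegral.integral_mul_const, intervalIntegral.integral_neg,
    integral_eq_sub_of_hasDerivAt (fun s hs => hw s (hu ▸ hs)) hi] at h1
  have h2 : ‖(w b : ℂ) * ∫ t in a..b, g t‖ ≤ w b * K := by
    rw [norm_mul, Complex.norm_real, Real.norm_eq_abs, abs_of_nonneg hwb]
    exact mul_le_mul_of_nonneg_left (hK b ⟨hab, le_rfl⟩) hwb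
  rw [integral_same, mul_zero, sub_zero]
  refine (norm_sub_le _ _).trans ?_
  linarith

/-- First derivative test, increasing positive derivative. -/
theorem norm_integral_cis_le_of_deriv {φ φ₁ φ₂ : ℝ → ℝ} {a b η : ℝ} (hη : 0 < η) (hab : a ≤ b)
    (h₁ : ∀ s, HasDerivAt φ (φ₁ s) s) (h₂ : ∀ s, HasDerivAt φ₁ (φ₂ s) s) (hc : Continuous φ₂)
    (hpos : ∀ s ∈ Icc a b, 0 ≤ φ₂ s) (hl : ∀ s ∈ Icc a b, 1 ≤ φ₁ s * η) :
    ‖∫ s in a..b, cis φ s‖ ≤ 2 * η := by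
  have c₁ : Continuous φ₁ := continuous_iff_continuousAt.2 fun s => (h₂ s).continuousAt
  have c₀ : Continuous φ := continuous_iff_continuousAt.2 fun s => (h₁ s).continuousAt
  have hp : ∀ s ∈ Icc a b, 0 < φ₁ s := fun s hs => by
    have := hl s hs
    by_contra! h
    nlinarith
  have hgc : Continuous fun s => Complex.I * φ₁ s * cis φ s := by
    have := continuous_cis c₀
    fun_prop
  -- `cis φ` is its own derivative times `1 / (iφ₁)`: the amplitude `1/φ₁` decreases, and the
  -- primitive of the derivative is a difference of two unit numbers, whence `K = 2`.
  have key := norm_integral_mul_le (g := fun s => Complex.I * φ₁ s * cis φ s)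
    (w := fun s => (φ₁ s)⁻¹) (w' := fun s => -φ₂ s / φ₁ s ^ 2) (K := 2) hgc hab
    (fun s hs => (h₂ s).inv (hp s hs).ne')
    ((hc.neg.continuousOn).div (c₁.pow 2).continuousOn fun s hs => (pow_pos (hp s hs) 2).ne')
    (fun s hs => div_nonpos_of_nonpos_of_nonneg (neg_nonpos.2 (hpos s hs)) (by positivity))
    (inv_nonneg.2 (hp b ⟨hab, le_rfl⟩).le)
    (fun s _ => by
      rw [integral_eq_sub_of_hasDerivAt (fun t _ => hasDerivAt_cis (h₁ t))
        (hgc.intervalIntegrable _ _)]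
      refine (norm_sub_le _ _).trans ?_
      rw [norm_cis, norm_cis]; norm_num)
  have h3 : ∫ s in a..b, ((φ₁ s)⁻¹ : ℝ) * (Complex.I * φ₁ s * cis φ s) =
      Complex.I * ∫ s in a..b, cis φ s := by
    rw [← intervalIntegral.integral_const_mul]
    refine integral_congr fun s hs => ?_
    have : (φ₁ s : ℂ) ≠ 0 := by exact_mod_cast (hp s (uIcc_of_le hab ▸ hs)).ne'
    push_cast
    field_simp
  rw [h3, norm_mul, Complex.norm_I, one_mul] at key
  refine key.trans ?_
  have h4 : (φ₁ a)⁻¹ ≤ η := by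
    rw [inv_le_iff_one_le_mul₀ (hp a ⟨le_rfl, hab⟩), mul_comm]
    exact hl a ⟨le_rfl, hab⟩
  linarith

theorem norm_integral_cis_neg (φ : ℝ → ℝ) (a b : ℝ) :
    ‖∫ s in a..b, cis (fun t => -φ t) s‖ = ‖∫ s in a..b, cis φ s‖ := by
  have : ∀ s, cis (fun t => -φ t) s = conj (cis φ s) := fun s => by
    rw [cis, cis, ← Complex.exp_conj]; simp
  simp_rw [this]
  rw [intervalIntegral_conj, RCLike.norm_conj]

theorem norm_integral_cis_comp_neg (φ : ℝ → ℝ) (a b : ℝ) :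
    ‖∫ s in a..b, cis (fun t => φ (-t)) s‖ = ‖∫ s in (-b)..(-a), cis φ s‖ := by
  rw [← integral_comp_neg]; rfl

/-- The reflection `s ↦ -s` reverses the sign of the first derivative and keeps that of the second.
-/
theorem norm_integral_cis_le_of_deriv_neg {φ φ₁ φ₂ : ℝ → ℝ} {a b η : ℝ} (hη : 0 < η) (hab : a ≤ b)
    (h₁ : ∀ s, HasDerivAt φ (φ₁ s) s) (h₂ : ∀ s, HasDerivAt φ₁ (φ₂ s) s) (hc : Continuous φ₂)
    (hpos : ∀ s ∈ Icc a b, 0 ≤ φ₂ s) (hl : ∀ s ∈ Icc a b, φ₁ s * η ≤ -1) :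
    ‖∫ s in a..b, cis φ s‖ ≤ 2 * η := by
  have := norm_integral_cis_le_of_deriv (φ := fun s => φ (-s)) (φ₁ := fun s => -φ₁ (-s))
    (φ₂ := fun s => φ₂ (-s)) (a := -b) (b := -a) hη (by linarith)
    (fun s => by simpa [Function.comp_def] using (h₁ (-s)).comp s (hasDerivAt_neg s))
    (fun s => by
      simpa only [Function.comp_def, mul_neg, mul_one, neg_neg] using
        ((h₂ (-s)).comp s (hasDerivAt_neg s)).fun_neg)
    (hc.comp continuous_neg) (fun s hs => hpos _ ⟨by linarith [hs.2], by linarith [hs.1]⟩)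
    (fun s hs => by have := hl (-s) ⟨by linarith [hs.2], by linarith [hs.1]⟩; linarith)
  rwa [norm_integral_cis_comp_neg, neg_neg, neg_neg] at this

/-- A function with derivative at least `l` is at least as far from zero as the line of slope `l`
through a suitable point. -/
theorem exists_split_point {g g' : ℝ → ℝ} {a b l : ℝ} (hab : a ≤ b)
    (hg : ∀ s, HasDerivAt g (g' s) s) (hl : ∀ s ∈ Icc a b, l ≤ g' s) :
    ∃ c ∈ Icc a b, (∀ s ∈ Icc a b, c < s → l * (s - c) ≤ g s) ∧
      ∀ s ∈ Icc a b, s < c → g s ≤ l * (s - c) := by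
  have hd : ∀ s, HasDerivAt (fun s => g s - l * s) (g' s - l) s := fun s => by
    simpa using (hg s).fun_sub ((hasDerivAt_id s).const_mul l)
  have hm : MonotoneOn (fun s => g s - l * s) (Icc a b) := by
    refine monotoneOn_of_deriv_nonneg (convex_Icc a b)
      (fun s _ => (hd s).continuousAt.continuousWithinAt)
      (fun s _ => (hd s).differentiableAt.differentiableWithinAt) fun s hs => ?_
    rw [(hd s).deriv]
    linarith [hl s (interior_subset hs)]
  have ha : a ∈ Icc a b := ⟨le_rfl, hab⟩
  have hb : b ∈ Icc a b := ⟨hab, le_rfl⟩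
  -- Without a sign change the split point is an endpoint; otherwise it is a zero of `g`.
  by_cases h0 : 0 ≤ g a
  · refine ⟨a, ha, fun s hs h => ?_, fun s hs h => absurd hs.1 (not_le.2 h)⟩
    have := hm ha hs h.le
    simp only at this
    linarith
  by_cases h1 : g b ≤ 0
  · refine ⟨b, hb, fun s hs h => absurd hs.2 (not_le.2 h), fun s hs h => ?_⟩
    have := hm hs hb h.le
    simp only at this
    linarith
  obtain ⟨c, hc, hgc⟩ := intermediate_value_Icc hab
    (fun s _ => (hg s).continuousAt.continuousWithinAt) ⟨(not_le.1 h0).le, (not_le.1 h1).le⟩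
  refine ⟨c, hc, fun s hs h => ?_, fun s hs h => ?_⟩
  · have := hm hc hs h.le
    simp only at this
    linarith
  · have := hm hs hc h.le
    simp only at this
    linarith

/-- The induction step of van der Corput's lemma. -/
theorem norm_integral_cis_le_step {φ g g' : ℝ → ℝ} {a b l K η : ℝ} (hη : 0 < η) (hl : 0 ≤ l)
    (hK : 0 ≤ K) (hab : a ≤ b) (hφ : Continuous φ)
    (hg : ∀ s, HasDerivAt g (g' s) s) (hlg : ∀ s ∈ Icc a b, l ≤ g' s)
    (hp : ∀ c d, a ≤ c → c ≤ d → d ≤ b → (∀ s ∈ Icc c d, l * η ≤ g s) →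
      ‖∫ s in c..d, cis φ s‖ ≤ K)
    (hn : ∀ c d, a ≤ c → c ≤ d → d ≤ b → (∀ s ∈ Icc c d, g s ≤ -(l * η)) →
      ‖∫ s in c..d, cis φ s‖ ≤ K) :
    ‖∫ s in a..b, cis φ s‖ ≤ 2 * K + 2 * η := by
  obtain ⟨c, hc, hr, hle⟩ := exists_split_point hab hg hlg
  have hi : ∀ x y, IntervalIntegrable (cis φ) volume x y := fun x y =>
    (continuous_cis hφ).intervalIntegrable _ _
  -- The window of radius `η` about `c` is estimated by its length; on either side of it `|g| ≥ lη`,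
  -- with a constant sign.
  set c₁ := max a (c - η)
  set c₂ := min b (c + η)
  have e₁ : a ≤ c₁ := le_max_left _ _
  have e₂ : c₁ ≤ c := max_le hc.1 (by linarith)
  have e₃ : c ≤ c₂ := le_min hc.2 (by linarith)
  have e₄ : c₂ ≤ b := min_le_left _ _
  have i₁ : ‖∫ s in a..c₁, cis φ s‖ ≤ K := by
    rcases le_total a (c - η) with h | h
    · refine hn _ _ le_rfl e₁ (by linarith) fun s hs => ?_
      have h' : c₁ = c - η := max_eq_right h
      have h2 : s ≤ c - η := h' ▸ hs.2
      have := hle s ⟨hs.1, by linarith⟩ (by linarith)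
      nlinarith
    · rw [show c₁ = a from max_eq_left h, integral_same, norm_zero]
      exact hK
  have i₃ : ‖∫ s in c₂..b, cis φ s‖ ≤ K := by
    rcases le_total (c + η) b with h | h
    · refine hp _ _ (by linarith) e₄ le_rfl fun s hs => ?_
      have h' : c₂ = c + η := min_eq_right h
      have h2 : c + η ≤ s := h' ▸ hs.1
      have := hr s ⟨by linarith, hs.2⟩ (by linarith)
      nlinarith
    · rw [show c₂ = b from min_eq_left h, integral_same, norm_zero]
      exact hK
  have i₂ : ‖∫ s in c₁..c₂, cis φ s‖ ≤ 2 * η := by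
    refine (norm_integral_cis_le φ (e₂.trans e₃)).trans ?_
    have h1 : c - η ≤ c₁ := le_max_right _ _
    have h2 : c₂ ≤ c + η := min_le_right _ _
    linarith
  rw [← integral_add_adjacent_intervals (hi a c₁) (hi c₁ b),
    ← integral_add_adjacent_intervals (hi c₁ c₂) (hi c₂ b)]
  refine (norm_add_le _ _).trans ?_
  have := norm_add_le (∫ s in c₁..c₂, cis φ s) (∫ s in c₂..b, cis φ s)
  linarith

/-- The induction step with `l = η⁻²` and `K = 2η` from the first derivative test, so `6 = 2·2 + 2`.
-/
theorem norm_integral_cis_le_of_deriv2_pos {φ φ₁ φ₂ : ℝ → ℝ} {a b η : ℝ} (hη : 0 < η)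
    (hab : a ≤ b) (h₁ : ∀ s, HasDerivAt φ (φ₁ s) s) (h₂ : ∀ s, HasDerivAt φ₁ (φ₂ s) s)
    (hc : Continuous φ₂) (hl : ∀ s ∈ Icc a b, 1 ≤ φ₂ s * η ^ 2) :
    ‖∫ s in a..b, cis φ s‖ ≤ 6 * η := by
  have hpos : ∀ s ∈ Icc a b, (η ^ 2)⁻¹ ≤ φ₂ s := fun s hs => by
    rw [inv_le_iff_one_le_mul₀ (by positivity)]
    linarith [hl s hs]
  have hpos' : ∀ s ∈ Icc a b, 0 ≤ φ₂ s := fun s hs =>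
    (by positivity : 0 ≤ (η ^ 2)⁻¹).trans (hpos s hs)
  have e : (η ^ 2)⁻¹ * η = η⁻¹ := by field_simp
  have e' : η⁻¹ * η = 1 := inv_mul_cancel₀ hη.ne'
  have := norm_integral_cis_le_step (φ := φ) (K := 2 * η) hη (by positivity) (by positivity) hab
    (continuous_iff_continuousAt.2 fun s => (h₁ s).continuousAt) h₂ hpos
    (fun c d hac hcd hdb h => norm_integral_cis_le_of_deriv hη hcd h₁ h₂ hc
      (fun s hs => hpos' s ⟨hac.trans hs.1, hs.2.trans hdb⟩) fun s hs => by
        have := h s hs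
        rw [e] at this
        nlinarith)
    (fun c d hac hcd hdb h => norm_integral_cis_le_of_deriv_neg hη hcd h₁ h₂ hc
      (fun s hs => hpos' s ⟨hac.trans hs.1, hs.2.trans hdb⟩) fun s hs => by
        have := h s hs
        rw [e] at this
        nlinarith)
  linarith

theorem norm_integral_cis_le_of_deriv2_neg {φ φ₁ φ₂ : ℝ → ℝ} {a b η : ℝ} (hη : 0 < η)
    (hab : a ≤ b) (h₁ : ∀ s, HasDerivAt φ (φ₁ s) s) (h₂ : ∀ s, HasDerivAt φ₁ (φ₂ s) s)
    (hc : Continuous φ₂) (hl : ∀ s ∈ Icc a b, φ₂ s * η ^ 2 ≤ -1) :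
    ‖∫ s in a..b, cis φ s‖ ≤ 6 * η := by
  rw [← norm_integral_cis_neg]
  exact norm_integral_cis_le_of_deriv2_pos hη hab (fun s => (h₁ s).fun_neg)
    (fun s => (h₂ s).fun_neg) hc.neg fun s hs => by linarith [hl s hs]

/-- The induction step with `l = η⁻³` and `K = 6η`, so `14 = 2·6 + 2`. -/
theorem norm_integral_cis_le_of_deriv3_pos {φ φ₁ φ₂ φ₃ : ℝ → ℝ} {a b η : ℝ} (hη : 0 < η)
    (hab : a ≤ b) (h₁ : ∀ s, HasDerivAt φ (φ₁ s) s) (h₂ : ∀ s, HasDerivAt φ₁ (φ₂ s) s)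
    (h₃ : ∀ s, HasDerivAt φ₂ (φ₃ s) s) (hl : ∀ s ∈ Icc a b, 1 ≤ φ₃ s * η ^ 3) :
    ‖∫ s in a..b, cis φ s‖ ≤ 14 * η := by
  have hc : Continuous φ₂ := continuous_iff_continuousAt.2 fun s => (h₃ s).continuousAt
  have hpos : ∀ s ∈ Icc a b, (η ^ 3)⁻¹ ≤ φ₃ s := fun s hs => by
    rw [inv_le_iff_one_le_mul₀ (by positivity)]
    linarith [hl s hs]
  have e : (η ^ 3)⁻¹ * η = (η ^ 2)⁻¹ := by field_simp
  have e' : (η ^ 2)⁻¹ * η ^ 2 = 1 := inv_mul_cancel₀ (by positivity)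
  have e2 : 0 ≤ η ^ 2 := by positivity
  have := norm_integral_cis_le_step (φ := φ) (K := 6 * η) hη (by positivity) (by positivity) hab
    (continuous_iff_continuousAt.2 fun s => (h₁ s).continuousAt) h₃ hpos
    (fun c d hac hcd hdb h => norm_integral_cis_le_of_deriv2_pos hη hcd h₁ h₂ hc fun s hs => by
        have := h s hs
        rw [e] at this
        nlinarith)
    (fun c d hac hcd hdb h => norm_integral_cis_le_of_deriv2_neg hη hcd h₁ h₂ hc fun s hs => by
        have := h s hs
        rw [e] at this
        nlinarith)
  linarith

theorem norm_integral_cis_le_of_deriv3_neg {φ φ₁ φ₂ φ₃ : ℝ → ℝ} {a b η : ℝ} (hη : 0 < η)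
    (hab : a ≤ b) (h₁ : ∀ s, HasDerivAt φ (φ₁ s) s) (h₂ : ∀ s, HasDerivAt φ₁ (φ₂ s) s)
    (h₃ : ∀ s, HasDerivAt φ₂ (φ₃ s) s) (hl : ∀ s ∈ Icc a b, φ₃ s * η ^ 3 ≤ -1) :
    ‖∫ s in a..b, cis φ s‖ ≤ 14 * η := by
  rw [← norm_integral_cis_neg]
  exact norm_integral_cis_le_of_deriv3_pos hη hab (fun s => (h₁ s).fun_neg)
    (fun s => (h₂ s).fun_neg) (fun s => (h₃ s).fun_neg) fun s hs => by linarith [hl s hs]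

/-! ### Decay of order `r^{-1/3}` for the cosine phase, uniformly in `β` and `L`. -/

/-- The phase `r cos(β - s) + L s`. -/
noncomputable def cosPhase (r β L s : ℝ) : ℝ := r * Real.cos (β - s) + L * s

theorem hasDerivAt_cosPhase (r β L s : ℝ) :
    HasDerivAt (cosPhase r β L) (r * Real.sin (β - s) + L) s := by
  have h := ((((hasDerivAt_id s).const_sub β).cos).const_mul r).fun_add
    ((hasDerivAt_id s).const_mul L)
  simpa [cosPhase] using! h

theorem hasDerivAt_cosPhase_deriv (r β L s : ℝ) :
    HasDerivAt (fun s => r * Real.sin (β - s) + L) (-(r * Real.cos (β - s))) s := by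
  have h := ((((hasDerivAt_id s).const_sub β).sin).const_mul r).add_const L
  simpa using! h

theorem hasDerivAt_cosPhase_deriv2 (r β s : ℝ) :
    HasDerivAt (fun s => -(r * Real.cos (β - s))) (-(r * Real.sin (β - s))) s := by
  have h := ((((hasDerivAt_id s).const_sub β).cos).const_mul r).fun_neg
  simpa using! h

theorem continuous_cosPhase (r β L : ℝ) : Continuous (cosPhase r β L) := by
  unfold cosPhase; fun_prop

/-- At `a` the sine or the cosine is at least `1/2` in absolute value, and on a length `1/4` it
moves by at most `1/4`. So the second or the third derivative keeps its sign and has size at least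
`r/4`; the slope `L` enters neither. The factor `1/4` is absorbed by running the tests at scale
`2η`, whence `28 = 14·2`. -/
theorem norm_integral_cosPhase_le_of_short {r η β L a b : ℝ} (hη : 0 < η) (hr : r * η ^ 3 = 1)
    (hab : a ≤ b) (hb : b ≤ a + 1 / 4) : ‖∫ s in a..b, cis (cosPhase r β L) s‖ ≤ 28 * η := by
  rcases le_or_gt 1 η with h1 | h1
  · exact (norm_integral_cis_le _ hab).trans (by linarith)
  have hc : Continuous fun s => -(r * Real.cos (β - s)) := by fun_prop
  have hr0 : 0 < r := by
    have : 0 < η ^ 3 := by positivity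
    by_contra! h
    nlinarith
  have hr2 : 1 ≤ r * η ^ 2 := by
    have : 0 ≤ r * η ^ 2 := by positivity
    nlinarith
  have lip : ∀ s ∈ Icc a b, |(β - s) - (β - a)| ≤ 1 / 4 := fun s hs => by
    rw [abs_le]
    constructor <;> linarith [hs.1, hs.2]
  have lc : ∀ s ∈ Icc a b, |Real.cos (β - s) - Real.cos (β - a)| ≤ 1 / 4 := fun s hs =>
    (Real.abs_cos_sub_cos_le _ _).trans (lip s hs)
  have ls : ∀ s ∈ Icc a b, |Real.sin (β - s) - Real.sin (β - a)| ≤ 1 / 4 := fun s hs =>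
    (Real.abs_sin_sub_sin_le _ _).trans (lip s hs)
  have hη2 : 0 < 2 * η := by linarith
  have hsq := Real.sin_sq_add_cos_sq (β - a)
  rcases le_or_gt (1 / 2) (Real.cos (β - a)) with k1 | k1
  · refine (norm_integral_cis_le_of_deriv2_neg hη2 hab (hasDerivAt_cosPhase r β L)
      (hasDerivAt_cosPhase_deriv r β L) hc fun s hs => ?_).trans (by linarith)
    have := (abs_le.1 (lc s hs)).1
    nlinarith
  rcases le_or_gt (Real.cos (β - a)) (-1 / 2) with k2 | k2
  · refine (norm_integral_cis_le_of_deriv2_pos hη2 hab (hasDerivAt_cosPhase r β L)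
      (hasDerivAt_cosPhase_deriv r β L) hc fun s hs => ?_).trans (by linarith)
    have := (abs_le.1 (lc s hs)).2
    nlinarith
  rcases le_or_gt (1 / 2) (Real.sin (β - a)) with k3 | k3
  · refine (norm_integral_cis_le_of_deriv3_neg hη2 hab (hasDerivAt_cosPhase r β L)
      (hasDerivAt_cosPhase_deriv r β L) (hasDerivAt_cosPhase_deriv2 r β) fun s hs => ?_).trans
        (by linarith)
    have := (abs_le.1 (ls s hs)).1
    have e : -(r * Real.sin (β - s)) * (2 * η) ^ 3 = -8 * Real.sin (β - s) * (r * η ^ 3) := by ring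
    rw [e, hr]
    linarith
  rcases le_or_gt (Real.sin (β - a)) (-1 / 2) with k4 | k4
  · refine (norm_integral_cis_le_of_deriv3_pos hη2 hab (hasDerivAt_cosPhase r β L)
      (hasDerivAt_cosPhase_deriv r β L) (hasDerivAt_cosPhase_deriv2 r β) fun s hs => ?_).trans
        (by linarith)
    have := (abs_le.1 (ls s hs)).2
    have e : -(r * Real.sin (β - s)) * (2 * η) ^ 3 = -8 * Real.sin (β - s) * (r * η ^ 3) := by ring
    rw [e, hr]
    linarith
  -- Sine and cosine both below `1/2` in absolute value contradict `sin² + cos² = 1`.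
  nlinarith

theorem norm_integral_cosPhase_le_of_le_add {r η β L : ℝ} (hη : 0 < η) (hr : r * η ^ 3 = 1)
    (n : ℕ) : ∀ a b : ℝ, a ≤ b → b ≤ a + n / 4 →
      ‖∫ s in a..b, cis (cosPhase r β L) s‖ ≤ n * (28 * η) := by
  induction n with
  | zero =>
    intro a b hab hb
    rw [le_antisymm hab (by simpa using hb)]
    simp
  | succ n ih =>
    intro a b hab hb
    push_cast at hb ⊢
    rcases le_or_gt b (a + 1 / 4) with h | h
    · have := norm_integral_cosPhase_le_of_short (β := β) (L := L) hη hr hab h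
      have h0 : 0 ≤ (n : ℝ) * (28 * η) := by positivity
      linarith
    · have hi : ∀ x y, IntervalIntegrable (cis (cosPhase r β L)) volume x y := fun x y =>
        (continuous_cis (continuous_cosPhase r β L)).intervalIntegrable _ _
      rw [← integral_add_adjacent_intervals (hi a (a + 1 / 4)) (hi _ b)]
      refine (norm_add_le _ _).trans ?_
      have h1 := norm_integral_cosPhase_le_of_short (β := β) (L := L) (a := a) (b := a + 1 / 4)
        hη hr (by linarith) le_rfl
      have h2 := ih (a + 1 / 4) b h.le (by linarith)
      linarith

theorem norm_integral_cosPhase_le {r η β L a b : ℝ} (hη : 0 < η) (hr : r * η ^ 3 = 1)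
    (hab : a ≤ b) (ha : 0 ≤ a) (hb : b ≤ π) : ‖∫ s in a..b, cis (cosPhase r β L) s‖ ≤ 448 * η := by
  -- Sixteen quarters cover a length of `4 ≥ π`, and `448 = 16·28`.
  have := norm_integral_cosPhase_le_of_le_add (β := β) (L := L) hη hr 16 a b hab
    (by have := Real.pi_le_four; push_cast; linarith)
  push_cast at this
  linarith

/-! ### Uniform bounds for singular integrals against the Dirichlet amplitude. -/

/-- The amplitude `1 / (2 sin(s/2))` of the Dirichlet kernel. -/
noncomputable def amp (s : ℝ) : ℝ := (2 * Real.sin (s / 2))⁻¹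

theorem sin_half_pos {s : ℝ} (h0 : 0 < s) (hπ : s ≤ π) : 0 < Real.sin (s / 2) :=
  Real.sin_pos_of_pos_of_lt_pi (by linarith) (by linarith [Real.pi_pos])

theorem amp_pos {s : ℝ} (h0 : 0 < s) (hπ : s ≤ π) : 0 < amp s := by
  have := sin_half_pos h0 hπ
  unfold amp
  positivity

theorem amp_le {s : ℝ} (h0 : 0 < s) (hπ : s ≤ π) : amp s ≤ 2 / s := by
  have h : 2 / π * (s / 2) ≤ Real.sin (s / 2) := Real.mul_le_sin (by linarith) (by linarith)
  have h2 : s / π ≤ Real.sin (s / 2) := by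
    have : 2 / π * (s / 2) = s / π := by ring
    linarith
  have h3 : s / 4 ≤ s / π := div_le_div_of_nonneg_left h0.le Real.pi_pos Real.pi_le_four
  rw [amp, inv_le_comm₀ (by linarith [sin_half_pos h0 hπ]) (by positivity), inv_div]
  linarith

theorem hasDerivAt_amp {s : ℝ} (h0 : 0 < s) (hπ : s ≤ π) :
    HasDerivAt amp (-(Real.cos (s / 2)) / (2 * Real.sin (s / 2)) ^ 2) s := by
  have h := ((((hasDerivAt_id s).div_const 2).sin).const_mul 2).fun_inv
    (by simpa using (sin_half_pos h0 hπ).ne')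
  refine HasDerivAt.congr_deriv (f := amp) h ?_
  simp only [id]
  ring

theorem continuousOn_amp : ContinuousOn amp (Ioc 0 π) := fun _ hs =>
  (hasDerivAt_amp hs.1 hs.2).continuousAt.continuousWithinAt

theorem intervalIntegrable_amp_mul {g : ℝ → ℂ} (hg : Continuous g) {a b : ℝ} (ha : 0 < a)
    (hab : a ≤ b) (hb : b ≤ π) :
    IntervalIntegrable (fun s => (amp s : ℂ) * g s) volume a b := by
  apply ContinuousOn.intervalIntegrable
  rw [uIcc_of_le hab]
  refine ContinuousOn.mul ?_ hg.continuousOn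
  exact Complex.continuous_ofReal.comp_continuousOn
    (continuousOn_amp.mono fun s hs => ⟨ha.trans_le hs.1, hs.2.trans hb⟩)

theorem norm_integral_amp_mul_le {g : ℝ → ℂ} (hg : Continuous g) {a b K : ℝ} (ha : 0 < a)
    (hab : a ≤ b) (hb : b ≤ π) (hK : ∀ s ∈ Icc a b, ‖∫ t in a..s, g t‖ ≤ K) :
    ‖∫ s in a..b, (amp s : ℂ) * g s‖ ≤ K * amp a := by
  have hs : ∀ s ∈ Icc a b, 0 < s ∧ s ≤ π := fun s hs => ⟨ha.trans_le hs.1, hs.2.trans hb⟩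
  refine norm_integral_mul_le hg hab (fun s h => hasDerivAt_amp (hs s h).1 (hs s h).2) ?_ ?_
    (amp_pos (ha.trans_le hab) hb).le hK
  · refine ContinuousOn.div (by fun_prop) (by fun_prop) fun s h => ?_
    have := sin_half_pos (hs s h).1 (hs s h).2
    positivity
  · intro s h
    refine div_nonpos_of_nonpos_of_nonneg (neg_nonpos.2 ?_) (by positivity)
    exact Real.cos_nonneg_of_mem_Icc ⟨by linarith [(hs s h).1, Real.pi_pos], by linarith [(hs s h).2]⟩

/-- If `D` is close to `D'` below the scale `δ` and oscillates at scale `δ` above it, then the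
integral of `D` against the Dirichlet amplitude reduces to an integral of `D'`. -/
theorem exists_integral_amp_sub_le {D D' : ℝ → ℂ} (hD : Continuous D) (hD' : Continuous D')
    {δ B K τ T : ℝ} (hδ : 0 < δ) (hB : 0 ≤ B) (hK : 0 ≤ K) (hτ : 0 < τ) (hτT : τ ≤ T) (hT : T ≤ π)
    (h₁ : ∀ s, 0 < s → s ≤ T → s ≤ δ → ‖D s - D' s‖ ≤ B * (s / δ))
    (h₂ : ∀ a b, δ ≤ a → a ≤ b → b ≤ T → ‖∫ s in a..b, D s‖ ≤ K * δ) :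
    ∃ T', τ ≤ T' ∧ T' ≤ T ∧
      ‖(∫ s in τ..T, (amp s : ℂ) * D s) - ∫ s in τ..T', (amp s : ℂ) * D' s‖ ≤ 2 * B + 2 * K := by
  -- The scale `δ` clamped to `[τ, T]`. Above it oscillation gives `Kδ · amp T' ≤ 2K`; below it the
  -- integrand is at most `2B/δ` on a length at most `δ`.
  set T' := max τ (min T δ) with hT'
  have e₁ : τ ≤ T' := le_max_left _ _
  have e₂ : T' ≤ T := max_le hτT (min_le_left _ _)
  refine ⟨T', e₁, e₂, ?_⟩
  have up : ‖∫ s in T'..T, (amp s : ℂ) * D s‖ ≤ 2 * K := by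
    rcases le_total T δ with h | h
    · have : T' = T := by rw [hT', min_eq_left h, max_eq_right hτT]
      rw [this, integral_same, norm_zero]
      positivity
    · have hd : δ ≤ T' := by rw [hT', min_eq_right h]; exact le_max_right _ _
      have hT0 : 0 < T' := hδ.trans_le hd
      refine (norm_integral_amp_mul_le hD hT0 e₂ hT
        fun s hs => h₂ _ _ hd hs.1 hs.2).trans ?_
      have h3 := amp_le hT0 (e₂.trans hT)
      have h4 : δ * (2 / T') ≤ 2 := by
        rw [mul_div_assoc', div_le_iff₀ hT0]
        linarith
      calc K * δ * amp T' ≤ K * δ * (2 / T') := by gcongr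
        _ = K * (δ * (2 / T')) := by ring
        _ ≤ K * 2 := by gcongr
        _ = 2 * K := by ring
  have low : ‖∫ s in τ..T', (amp s : ℂ) * (D s - D' s)‖ ≤ 2 * B := by
    rcases le_total δ τ with h | h
    · have : T' = τ := max_eq_left ((min_le_right _ _).trans h)
      rw [this, integral_same, norm_zero]
      positivity
    · have hd : T' ≤ δ := max_le h (min_le_right _ _)
      have := norm_integral_le_of_norm_le_const (a := τ) (b := T') (C := 2 * B / δ)
        (f := fun s => (amp s : ℂ) * (D s - D' s)) fun s hs => by
          rw [uIoc_of_le e₁] at hs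
          have hs0 : 0 < s := hτ.trans hs.1
          have hsπ : s ≤ π := hs.2.trans (e₂.trans hT)
          rw [norm_mul, Complex.norm_real, Real.norm_eq_abs, abs_of_pos (amp_pos hs0 hsπ)]
          calc amp s * ‖D s - D' s‖ ≤ 2 / s * (B * (s / δ)) :=
                mul_le_mul (amp_le hs0 hsπ) (h₁ s hs0 (hs.2.trans e₂) (hs.2.trans hd))
                  (norm_nonneg _) (by positivity)
            _ = 2 * B / δ := by field_simp
      refine this.trans ?_
      rw [abs_of_nonneg (sub_nonneg.2 e₁), div_mul_eq_mul_div, div_le_iff₀ hδ]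
      gcongr
      linarith
  have hπ := e₂.trans hT
  rw [← integral_add_adjacent_intervals (intervalIntegrable_amp_mul hD hτ e₁ hπ)
    (intervalIntegrable_amp_mul hD (hτ.trans_le e₁) e₂ hT), add_sub_right_comm,
    ← integral_sub (intervalIntegrable_amp_mul hD hτ e₁ hπ)
    (intervalIntegrable_amp_mul hD' hτ e₁ hπ)]
  simp_rw [← mul_sub]
  exact (norm_add_le _ _).trans (by linarith)

/-- A scale `δ` with `r δ ^ k = 1`, or a large one if `r = 0`. -/
theorem exists_scale {r : ℝ} (hr : 0 ≤ r) {k : ℕ} (hk : k ≠ 0) :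
    ∃ δ : ℝ, 0 < δ ∧ r * δ ^ k ≤ 1 ∧ (δ ≤ π → r * δ ^ k = 1) := by
  rcases hr.eq_or_lt with rfl | h
  -- For `r = 0` the scale exceeds `π`, so the oscillatory range is empty.
  · exact ⟨π + 1, by linarith [Real.pi_pos], by simp, fun h => by linarith⟩
  · have e : r * ((r⁻¹) ^ ((k : ℝ)⁻¹)) ^ k = 1 := by
      rw [Real.rpow_inv_natCast_pow (inv_nonneg.2 hr) hk, mul_inv_cancel₀ h.ne']
    exact ⟨_, by positivity, e.le, fun _ => e⟩

/-- The odd part `e^{iφ(s)} - e^{iφ(-s)}`. -/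
noncomputable def oddCis (φ : ℝ → ℝ) (s : ℝ) : ℂ := cis φ s - cis φ (-s)

theorem continuous_oddCis {φ : ℝ → ℝ} (h : Continuous φ) : Continuous (oddCis φ) :=
  (continuous_cis h).sub ((continuous_cis h).comp continuous_neg)

theorem norm_integral_oddCis_le {φ : ℝ → ℝ} (h : Continuous φ) {a b K : ℝ}
    (h₁ : ‖∫ s in a..b, cis φ s‖ ≤ K) (h₂ : ‖∫ s in a..b, cis (fun t => φ (-t)) s‖ ≤ K) :
    ‖∫ s in a..b, oddCis φ s‖ ≤ 2 * K := by
  have e : ∫ s in a..b, oddCis φ s =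
      (∫ s in a..b, cis φ s) - ∫ s in a..b, cis (fun t => φ (-t)) s :=
    integral_sub ((continuous_cis h).intervalIntegrable _ _)
      ((continuous_cis (h.comp continuous_neg)).intervalIntegrable _ _)
  rw [e]
  exact (norm_sub_le _ _).trans (by linarith)

theorem norm_oddCis_sub_le (φ χ : ℝ → ℝ) (s : ℝ) :
    ‖oddCis φ s - oddCis χ s‖ ≤ |φ s - χ s| + |φ (-s) - χ (-s)| := by
  have e : oddCis φ s - oddCis χ s = (cis φ s - cis χ s) - (cis φ (-s) - cis χ (-s)) := by
    unfold oddCis; ring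
  rw [e]
  exact (norm_sub_le _ _).trans
    (add_le_add (norm_cis_sub_cis_le _ _ _ _) (norm_cis_sub_cis_le _ _ _ _))

/-- The phase `c + A s + b s²`. -/
noncomputable def quadPhase (c A b s : ℝ) : ℝ := c + A * s + b * s ^ 2

theorem continuous_quadPhase (c A b : ℝ) : Continuous (quadPhase c A b) := by
  unfold quadPhase; fun_prop

theorem hasDerivAt_quadPhase (c A b s : ℝ) :
    HasDerivAt (quadPhase c A b) (A + 2 * b * s) s := by
  have h := (((hasDerivAt_id s).const_mul A).const_add c).fun_add
    (((hasDerivAt_id s).fun_pow 2).const_mul b)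
  refine HasDerivAt.congr_deriv (f := quadPhase c A b) h ?_
  simp
  ring

theorem hasDerivAt_quadPhase_deriv (A b s : ℝ) :
    HasDerivAt (fun s => A + 2 * b * s) (2 * b) s := by
  simpa using ((hasDerivAt_id s).const_mul (2 * b)).const_add A

theorem quadPhase_neg (c A b : ℝ) : (fun t => quadPhase c A b (-t)) = quadPhase c (-A) b := by
  funext t; unfold quadPhase; ring

theorem cosPhase_neg (r β L : ℝ) : (fun t => cosPhase r β L (-t)) = cosPhase r (-β) (-L) := by
  funext t
  unfold cosPhase
  rw [show β - -t = -(-β - t) by ring, Real.cos_neg]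
  ring

theorem norm_integral_linPhase_le {c A η a b : ℝ} (hη : 0 < η) (hA : |A| * η = 1) (hab : a ≤ b) :
    ‖∫ s in a..b, cis (quadPhase c A 0) s‖ ≤ 2 * η := by
  rcases le_or_gt 0 A with h | h
  · rw [abs_of_nonneg h] at hA
    exact norm_integral_cis_le_of_deriv hη hab (hasDerivAt_quadPhase c A 0)
      (hasDerivAt_quadPhase_deriv A 0) continuous_const (by simp) (by simp [hA])
  · rw [abs_of_neg h] at hA
    exact norm_integral_cis_le_of_deriv_neg hη hab (hasDerivAt_quadPhase c A 0)
      (hasDerivAt_quadPhase_deriv A 0) continuous_const (by simp)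
      (fun s _ => by simp; linarith)

theorem norm_integral_quadPhase_le {c A b η x y : ℝ} (hη : 0 < η) (hb : |b| * η ^ 2 = 1)
    (hxy : x ≤ y) : ‖∫ s in x..y, cis (quadPhase c A b) s‖ ≤ 6 * η := by
  rcases le_or_gt 0 b with h | h
  · rw [abs_of_nonneg h] at hb
    exact norm_integral_cis_le_of_deriv2_pos hη hxy (hasDerivAt_quadPhase c A b)
      (hasDerivAt_quadPhase_deriv A b) continuous_const (fun s _ => by linarith)
  · rw [abs_of_neg h] at hb
    exact norm_integral_cis_le_of_deriv2_neg hη hxy (hasDerivAt_quadPhase c A b)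
      (hasDerivAt_quadPhase_deriv A b) continuous_const (fun s _ => by linarith)

/-- Below the scale `1/|A|` the odd part is compared with `0`: it is `O(|A|s)`, which offsets the
non-integrable amplitude. -/
theorem norm_integral_amp_linPhase_le (c A : ℝ) {τ T : ℝ} (hτ : 0 < τ) (hτT : τ ≤ T) (hT : T ≤ π) :
    ‖∫ s in τ..T, (amp s : ℂ) * oddCis (quadPhase c A 0) s‖ ≤ 12 := by
  obtain ⟨δ, hδ, hle, heq⟩ := exists_scale (abs_nonneg A) one_ne_zero
  rw [pow_one] at hle heq
  obtain ⟨T', -, -, h⟩ := exists_integral_amp_sub_le (D' := fun _ => 0) (B := 2) (K := 4)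
    (continuous_oddCis (continuous_quadPhase c A 0)) continuous_const hδ
    (by norm_num) (by norm_num) hτ hτT hT
    (fun s hs _ _ => by
      rw [sub_zero]
      refine (norm_cis_sub_cis_le _ _ _ _).trans ?_
      have e : quadPhase c A 0 s - quadPhase c A 0 (-s) = 2 * (A * s) := by unfold quadPhase; ring
      rw [e, abs_mul, abs_mul, abs_of_pos hs, abs_two]
      gcongr
      rwa [le_div_iff₀ hδ, mul_right_comm, mul_le_iff_le_one_left hs])
    (fun a b ha hab hb => by
      have hA := heq ((ha.trans hab).trans (hb.trans hT))
      refine (norm_integral_oddCis_le (continuous_quadPhase c A 0) (K := 2 * δ)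
        (norm_integral_linPhase_le hδ hA hab) ?_).trans (by linarith)
      rw [quadPhase_neg]
      exact norm_integral_linPhase_le hδ (by rwa [abs_neg]) hab)
  simpa [show (2 : ℝ) * 2 + 2 * 4 = 12 by norm_num] using h

/-- Below the scale `|b|^{-1/2}` the quadratic term is dropped. The linear case on the shortened
interval adds `12`: `40 = (2·2 + 2·12) + 12`. -/
theorem norm_integral_amp_quadPhase_le (c A b : ℝ) {τ T : ℝ} (hτ : 0 < τ) (hτT : τ ≤ T)
    (hT : T ≤ π) : ‖∫ s in τ..T, (amp s : ℂ) * oddCis (quadPhase c A b) s‖ ≤ 40 := by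
  obtain ⟨δ, hδ, hle, heq⟩ := exists_scale (abs_nonneg b) two_ne_zero
  obtain ⟨T', h1, h2, h⟩ := exists_integral_amp_sub_le (D' := oddCis (quadPhase c A 0)) (B := 2)
    (K := 12) (continuous_oddCis (continuous_quadPhase c A b))
    (continuous_oddCis (continuous_quadPhase c A 0)) hδ (by norm_num) (by norm_num) hτ hτT hT
    (fun s hs _ hsδ => by
      refine (norm_oddCis_sub_le _ _ _).trans ?_
      have e : quadPhase c A b s - quadPhase c A 0 s = b * s ^ 2 := by unfold quadPhase; ring
      have e' : quadPhase c A b (-s) - quadPhase c A 0 (-s) = b * s ^ 2 := by unfold quadPhase; ring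
      rw [e, e', ← two_mul, abs_mul, abs_of_nonneg (sq_nonneg s)]
      gcongr
      rw [le_div_iff₀ hδ]
      calc |b| * s ^ 2 * δ = s * (|b| * (s * δ)) := by ring
        _ ≤ s * (|b| * (δ * δ)) := by gcongr
        _ = s * (|b| * δ ^ 2) := by ring
        _ ≤ s := mul_le_of_le_one_right hs.le hle)
    (fun x y ha hab hb => by
      have hA := heq ((ha.trans hab).trans (hb.trans hT))
      refine (norm_integral_oddCis_le (continuous_quadPhase c A b) (K := 6 * δ)
        (norm_integral_quadPhase_le hδ hA hab) ?_).trans (by linarith)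
      rw [quadPhase_neg]
      exact norm_integral_quadPhase_le hδ hA hab)
  have h3 := norm_integral_amp_linPhase_le c A hτ h1 (h2.trans hT)
  have := norm_sub_norm_le (∫ s in τ..T, (amp s : ℂ) * oddCis (quadPhase c A b) s)
    (∫ s in τ..T', (amp s : ℂ) * oddCis (quadPhase c A 0) s)
  linarith

/-- Second order Taylor expansion of the phase at `0`. -/
theorem abs_cosPhase_sub_quadPhase_le {r : ℝ} (hr : 0 ≤ r) (β L : ℝ) {s : ℝ} (hs : |s| ≤ 4) :
    |cosPhase r β L s -
      quadPhase (r * Real.cos β) (r * Real.sin β + L) (-(r * Real.cos β) / 2) s| ≤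
      r * |s| ^ 3 := by
  have e : cosPhase r β L s -
      quadPhase (r * Real.cos β) (r * Real.sin β + L) (-(r * Real.cos β) / 2) s =
      r * (Real.cos β * (Real.cos s - 1 + s ^ 2 / 2) + Real.sin β * (Real.sin s - s)) := by
    unfold cosPhase quadPhase
    rw [Real.cos_sub]
    ring
  have h1 : |Real.sin s - s| ≤ |s| ^ 3 / 6 := (abs_sub_comm _ _).trans_le (Real.abs_sub_sin_le s)
  have h2 : |Real.cos s - 1 + s ^ 2 / 2| ≤ |s| ^ 3 / 6 := by
    -- The half-angle formula and a difference of squares reduce the cosine remainder to the cubic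
    -- bound for the sine.
    have e2 : Real.cos s - 1 + s ^ 2 / 2 =
        -(2 * ((Real.sin (s / 2) - s / 2) * (Real.sin (s / 2) + s / 2))) := by
      have h := Real.cos_two_mul (s / 2)
      rw [mul_div_cancel₀ s two_ne_zero] at h
      have h' := Real.sin_sq_add_cos_sq (s / 2)
      nlinarith
    have h3 := (abs_sub_comm _ _).trans_le (Real.abs_sub_sin_le (s / 2))
    have h4 : |Real.sin (s / 2) + s / 2| ≤ 4 := by
      refine (abs_add_le _ _).trans ?_
      have h5 := Real.abs_sin_le_abs (x := s / 2)
      rw [abs_div, abs_two] at *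
      linarith
    rw [e2, abs_neg, abs_mul, abs_mul, abs_two]
    rw [abs_div, abs_two, div_pow] at h3
    have h5 := mul_le_mul h3 h4 (abs_nonneg _) (by positivity)
    linarith
  rw [e, abs_mul, abs_of_nonneg hr]
  gcongr
  refine (abs_add_le _ _).trans ?_
  rw [abs_mul, abs_mul]
  have h3 := mul_le_mul (Real.abs_cos_le_one β) h2 (abs_nonneg _) zero_le_one
  have h4 := mul_le_mul (Real.abs_sin_le_one β) h1 (abs_nonneg _) zero_le_one
  have h5 : 0 ≤ |s| ^ 3 := by positivity
  linarith

/-- Below the scale `r^{-1/3}` the phase is replaced by its quadratic Taylor polynomial at `0`. With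
`K = 2·448`, `1836 = (2·2 + 2·896) + 40`. -/
theorem norm_integral_amp_cosPhase_le {r : ℝ} (hr : 0 ≤ r) (β L : ℝ) {τ : ℝ} (hτ : 0 < τ)
    (hτT : τ ≤ π) : ‖∫ s in τ..π, (amp s : ℂ) * oddCis (cosPhase r β L) s‖ ≤ 1836 := by
  obtain ⟨δ, hδ, hle, heq⟩ := exists_scale hr three_ne_zero
  set q := quadPhase (r * Real.cos β) (r * Real.sin β + L) (-(r * Real.cos β) / 2)
  obtain ⟨T', h1, h2, h⟩ := exists_integral_amp_sub_le (D' := oddCis q) (B := 2)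
    (K := 896) (continuous_oddCis (continuous_cosPhase r β L))
    (continuous_oddCis (continuous_quadPhase _ _ _)) hδ (by norm_num) (by norm_num) hτ hτT le_rfl
    (fun s hs hsπ hsδ => by
      refine (norm_oddCis_sub_le _ _ _).trans ?_
      have hs4 : |s| ≤ 4 := by
        rw [abs_of_pos hs]
        exact hsπ.trans Real.pi_le_four
      have e := abs_cosPhase_sub_quadPhase_le hr β L hs4
      have e' := abs_cosPhase_sub_quadPhase_le hr β L (s := -s) (by rwa [abs_neg])
      rw [abs_neg] at e'
      rw [abs_of_pos hs] at e e'
      have : r * s ^ 3 ≤ s / δ := by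
        rw [le_div_iff₀ hδ]
        calc r * s ^ 3 * δ = s * (r * (s * s * δ)) := by ring
          _ ≤ s * (r * (δ * δ * δ)) := by gcongr
          _ = s * (r * δ ^ 3) := by ring
          _ ≤ s := mul_le_of_le_one_right hs.le hle
      linarith)
    (fun x y ha hab hb => by
      have hA := heq ((ha.trans hab).trans hb)
      refine (norm_integral_oddCis_le (continuous_cosPhase r β L) (K := 448 * δ)
        (norm_integral_cosPhase_le hδ hA hab (hδ.le.trans ha) hb) ?_).trans (by linarith)
      rw [cosPhase_neg]
      exact norm_integral_cosPhase_le hδ hA hab (hδ.le.trans ha) hb)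
  have h3 : ‖∫ s in τ..T', (amp s : ℂ) * oddCis q s‖ ≤ 40 :=
    norm_integral_amp_quadPhase_le _ _ _ hτ h1 h2
  have := norm_sub_norm_le (∫ s in τ..π, (amp s : ℂ) * oddCis (cosPhase r β L) s)
    (∫ s in τ..T', (amp s : ℂ) * oddCis q s)
  linarith

/-! ### Dirichlet kernels against the cosine phase. -/

theorem sum_Icc_exp_mul (s : ℝ) {A B : ℤ} (h : A - 1 ≤ B) :
    (∑ j ∈ Finset.Icc A B, Complex.exp (Complex.I * j * s)) *
        (2 * Complex.I * Real.sin (s / 2)) =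
      Complex.exp (Complex.I * (B + 1 / 2) * s) - Complex.exp (Complex.I * (A - 1 / 2) * s) := by
  induction B, h using Int.leInduction with
  | base =>
    rw [Finset.Icc_eq_empty (by omega)]
    push_cast
    rw [show (A : ℂ) - 1 + 1 / 2 = A - 1 / 2 by ring]
    simp
  | succ B hB ih =>
    have e : Finset.Icc A (B + 1) = insert (B + 1) (Finset.Icc A B) := by
      ext x; simp only [Finset.mem_Icc, Finset.mem_insert]; omega
    have h2 : 2 * Complex.I * (Real.sin (s / 2) : ℂ) =
        Complex.exp (Complex.I * s / 2) - Complex.exp (-(Complex.I * s / 2)) := by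
      have h3 : (Real.sin (s / 2) : ℂ) = Complex.sin (s / 2) := by push_cast; rfl
      rw [h3, mul_right_comm, Complex.two_sin,
        show -((s : ℂ) / 2) * Complex.I = -(Complex.I * s / 2) by ring,
        show (s : ℂ) / 2 * Complex.I = Complex.I * s / 2 by ring, mul_assoc, Complex.I_mul_I]
      ring
    rw [e, Finset.sum_insert (by simp), add_mul, ih, h2, mul_sub, ← Complex.exp_add,
      ← Complex.exp_add]
    push_cast
    ring_nf

/-- The Dirichlet type kernel `∑_{A ≤ j ≤ B} e^{ijs}` against `e^{ir cos(β - s)}`. -/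
noncomputable def kernelProd (r β : ℝ) (A B : ℤ) (s : ℝ) : ℂ :=
  (∑ j ∈ Finset.Icc A B, Complex.exp (Complex.I * j * s)) * cis (cosPhase r β 0) s

theorem continuous_kernelProd (r β : ℝ) (A B : ℤ) : Continuous (kernelProd r β A B) := by
  have := continuous_cis (continuous_cosPhase r β 0)
  unfold kernelProd
  fun_prop

theorem exp_mul_cis (r β L s : ℝ) :
    Complex.exp (Complex.I * L * s) * cis (cosPhase r β 0) s = cis (cosPhase r β L) s := by
  rw [cis, cis, ← Complex.exp_add, cosPhase, cosPhase]
  push_cast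
  ring_nf

theorem kernelProd_mul (r β : ℝ) {A B : ℤ} (h : A - 1 ≤ B) (s : ℝ) :
    kernelProd r β A B s * (2 * Complex.I * Real.sin (s / 2)) =
      cis (cosPhase r β (B + 1 / 2)) s - cis (cosPhase r β (A - 1 / 2)) s := by
  rw [kernelProd, mul_right_comm, sum_Icc_exp_mul s h, sub_mul, ← exp_mul_cis r β (B + 1 / 2),
    ← exp_mul_cis r β (A - 1 / 2)]
  push_cast
  rfl

/-- Since `sin(s/2)` is odd, adding the values at `s` and `-s` leaves the odd parts of the two waves
whose slopes are the end frequencies shifted by `1/2`. -/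
theorem kernelProd_add_neg (r β : ℝ) {A B : ℤ} (h : A - 1 ≤ B) {s : ℝ} (h0 : 0 < s) (hπ : s ≤ π) :
    kernelProd r β A B s + kernelProd r β A B (-s) =
      -Complex.I * ((amp s : ℂ) * oddCis (cosPhase r β (B + 1 / 2)) s -
        (amp s : ℂ) * oddCis (cosPhase r β (A - 1 / 2)) s) := by
  have h1 := kernelProd_mul r β h s
  have h2 := kernelProd_mul r β h (-s)
  have hs : (Real.sin (s / 2) : ℂ) ≠ 0 := by exact_mod_cast (sin_half_pos h0 hπ).ne'
  rw [neg_div, Real.sin_neg] at h2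
  have e : oddCis (cosPhase r β (B + 1 / 2)) s - oddCis (cosPhase r β (A - 1 / 2)) s =
      (kernelProd r β A B s + kernelProd r β A B (-s)) * (2 * Complex.I * Real.sin (s / 2)) := by
    unfold oddCis
    push_cast at h2 ⊢
    push_cast at h1
    linear_combination -h1 + h2
  rw [← mul_sub, e, amp]
  push_cast at hs ⊢
  field_simp
  rw [Complex.I_sq]
  ring

theorem norm_integral_kernelProd_le {r : ℝ} (hr : 0 ≤ r) (β : ℝ) (A B : ℤ) :
    ‖∫ s in (-π)..π, kernelProd r β A B s‖ ≤ 3672 := by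
  rcases le_or_gt (A - 1) B with h | h
  swap
  · have : kernelProd r β A B = fun _ => 0 := by
      funext s
      rw [kernelProd, Finset.Icc_eq_empty (by omega)]
      simp
    simp [this]
  have hc := continuous_kernelProd r β A B
  have hc' : Continuous fun s => kernelProd r β A B (-s) := hc.comp continuous_neg
  have e : ∫ s in (-π)..π, kernelProd r β A B s =
      ∫ s in (0 : ℝ)..π, (kernelProd r β A B s + kernelProd r β A B (-s)) := by
    rw [intervalIntegral.integral_add (hc.intervalIntegrable _ _) (hc'.intervalIntegrable _ _),
      intervalIntegral.integral_comp_neg, neg_zero, add_comm,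
      integral_add_adjacent_intervals (hc.intervalIntegrable _ _) (hc.intervalIntegrable _ _)]
  rw [e]
  have hcc : Continuous fun s => kernelProd r β A B s + kernelProd r β A B (-s) := hc.add hc'
  -- The amplitude is singular at `0`, so the two odd parts are separated only on `[τ, π]`; the
  -- bound `2·1836` survives `τ → 0` because the folded kernel is continuous.
  have hlim : Filter.Tendsto
      (fun τ => ‖∫ s in τ..π, (kernelProd r β A B s + kernelProd r β A B (-s))‖)
      (nhdsWithin 0 (Ioi 0))
      (nhds ‖∫ s in (0 : ℝ)..π, (kernelProd r β A B s + kernelProd r β A B (-s))‖) := by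
    refine (Continuous.tendsto ?_ 0).mono_left nhdsWithin_le_nhds
    simp_rw [integral_symm π]
    exact ((continuous_primitive (fun a b => hcc.intervalIntegrable a b) π).neg).norm
  refine le_of_tendsto hlim ?_
  filter_upwards [Ioc_mem_nhdsGT Real.pi_pos] with τ hτ
  have e2 : ∫ s in τ..π, (kernelProd r β A B s + kernelProd r β A B (-s)) =
      -Complex.I * ((∫ s in τ..π, (amp s : ℂ) * oddCis (cosPhase r β (B + 1 / 2)) s) -
        ∫ s in τ..π, (amp s : ℂ) * oddCis (cosPhase r β (A - 1 / 2)) s) := by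
    have hi : ∀ L, IntervalIntegrable (fun s => (amp s : ℂ) * oddCis (cosPhase r β L) s)
        volume τ π := fun L =>
      intervalIntegrable_amp_mul (continuous_oddCis (continuous_cosPhase r β L)) hτ.1 hτ.2 le_rfl
    rw [← intervalIntegral.integral_sub (hi _) (hi _), ← intervalIntegral.integral_const_mul]
    refine integral_congr fun s hs => ?_
    rw [uIcc_of_le hτ.2] at hs
    exact kernelProd_add_neg r β h (hτ.1.trans_le hs.1) hs.2
  rw [e2, norm_mul, norm_neg, Complex.norm_I, one_mul]
  refine (norm_sub_le _ _).trans ?_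
  have h1 := norm_integral_amp_cosPhase_le hr β (B + 1 / 2) hτ.1 hτ.2
  have h2 := norm_integral_amp_cosPhase_le hr β (A - 1 / 2) hτ.1 hτ.2
  linarith

end Oscillatory

namespace SE2Fourier

open Oscillatory

/-! ### Fourier series of plane waves on the circle. -/

theorem fourier_coe_two_pi (n : ℤ) (θ : ℝ) :
    fourier n (θ : Angle) = Complex.exp (Complex.I * n * θ) := by
  rw [fourier_coe_apply]
  congr 1
  have : (π : ℂ) ≠ 0 := by exact_mod_cast Real.pi_ne_zero
  push_cast
  field_simp

/-- On the circle, `phase ε p x` is a wave `e^{ir cos(β - θ)}`. -/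
theorem exists_phase_eq_cis (ε : ℤˣ) (p : ℝ) (x : ℂ) :
    ∃ r β : ℝ, 0 ≤ r ∧ ∀ θ : ℝ, phase ε p x (θ : Angle) = cis (cosPhase r β 0) θ := by
  set w : ℂ := (((ε : ℤ) : ℝ) * p : ℝ) * x with hw
  refine ⟨‖w‖, Complex.arg w, norm_nonneg _, fun θ => ?_⟩
  have h1 := Complex.norm_mul_cos_arg w
  have h2 := Complex.norm_mul_sin_arg w
  have r1 : w.re = ((ε : ℤ) : ℝ) * p * x.re := by rw [hw, Complex.re_ofReal_mul]
  have r2 : w.im = ((ε : ℤ) : ℝ) * p * x.im := by rw [hw, Complex.im_ofReal_mul]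
  have u1 : (unitVec (θ : Angle)).re = Real.cos θ := by
    rw [SE2.unitVec_coe]; simp [-Complex.ofReal_cos, -Complex.ofReal_sin]
  have u2 : (unitVec (θ : Angle)).im = Real.sin θ := by
    rw [SE2.unitVec_coe]; simp [-Complex.ofReal_cos, -Complex.ofReal_sin]
  rw [phase, cis, mul_comm, u1, u2]
  congr 3
  rw [cosPhase, Real.cos_sub]
  linear_combination (-Real.cos θ) * (h1.trans r1) - Real.sin θ * (h2.trans r2)

theorem fourierCoeff_mul_fourier_eq (h : Angle → ℂ) (j : ℤ) (φ : ℝ) :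
    fourierCoeff h j • fourier j (φ : Angle) =
      (1 / (2 * π) : ℝ) • ∫ s in (-π)..π, Complex.exp (Complex.I * j * s) * h ((φ - s : ℝ) : Angle) := by
  rw [fourierCoeff_eq_intervalIntegral h j (φ - π), smul_assoc, smul_eq_mul]
  congr 1
  rw [← intervalIntegral.integral_mul_const]
  have e : φ - π + 2 * π = φ - -π := by ring
  rw [e, ← intervalIntegral.integral_comp_sub_left
    (fun x : ℝ => fourier (-j) (x : Angle) • h x * fourier j (φ : Angle)) φ]
  refine intervalIntegral.integral_congr fun s _ => ?_
  simp only [smul_eq_mul]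
  rw [mul_right_comm, fourier_coe_two_pi, fourier_coe_two_pi, ← Complex.exp_add]
  congr 2
  push_cast
  ring

/-- The partial sums of the Fourier series of the plane waves, restricted to circles, are uniformly
bounded. -/
theorem norm_sum_fourierCoeff_phase_le (ε : ℤˣ) (p : ℝ) (x : ℂ) (A B : ℤ) (φ : Angle) :
    ‖∑ j ∈ Finset.Icc A B, fourierCoeff (phase ε p x) j • fourier j φ‖ ≤ 3672 := by
  induction φ using QuotientAddGroup.induction_on with | _ φ => ?_
  obtain ⟨r, β, hr, hβ⟩ := exists_phase_eq_cis ε p x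
  -- The evaluation point only changes the angle `β`, on which the kernel bound does not depend.
  have e : ∀ s : ℝ, phase ε p x ((φ - s : ℝ) : Angle) = cis (cosPhase r (φ - β) 0) s := fun s => by
    rw [hβ, cis, cis, cosPhase, cosPhase, show β - (φ - s) = -(φ - β - s) by ring, Real.cos_neg]
    simp
  have e1 : ∑ j ∈ Finset.Icc A B, fourierCoeff (phase ε p x) j • fourier j (φ : Angle) =
      (1 / (2 * π) : ℝ) • ∫ s in (-π)..π, kernelProd r (φ - β) A B s := by
    simp_rw [fourierCoeff_mul_fourier_eq, e]
    rw [← Finset.smul_sum, ← intervalIntegral.integral_finsetSum]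
    · simp_rw [kernelProd, Finset.sum_mul]
    · intro j _
      have := continuous_cis (continuous_cosPhase r (φ - β) 0)
      exact Continuous.intervalIntegrable (by fun_prop) _ _
  refine (congrArg norm e1).trans_le ?_
  rw [norm_smul, Real.norm_eq_abs, abs_of_pos (by positivity)]
  have h1 := norm_integral_kernelProd_le hr (φ - β) A B
  have h2 : 1 / (2 * π) ≤ 1 := by
    rw [div_le_one (by positivity)]
    linarith [Real.pi_gt_three]
  calc _ ≤ 1 * (3672 : ℝ) := mul_le_mul h2 h1 (norm_nonneg _) zero_le_one
    _ = 3672 := one_mul _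

theorem integral_exp_mul_deriv {f f' : ℝ → ℂ} (hf : ∀ s, HasDerivAt f (f' s) s)
    (hf' : Continuous f') (hp : f (2 * π) = f 0) (n : ℤ) :
    ∫ s in (0 : ℝ)..2 * π, Complex.exp (-(Complex.I * n * s)) * f' s =
      Complex.I * n * ∫ s in (0 : ℝ)..2 * π, Complex.exp (-(Complex.I * n * s)) * f s := by
  have hE : ∀ s : ℝ, HasDerivAt (fun s : ℝ => Complex.exp (-(Complex.I * n * s)))
      (-(Complex.I * n) * Complex.exp (-(Complex.I * n * s))) s := fun s => by
    have := (((hasDerivAt_id s).ofReal_comp).const_mul (Complex.I * n)).fun_neg.cexp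
    refine this.congr_deriv ?_
    simp
    ring
  rw [intervalIntegral.integral_mul_deriv_eq_deriv_mul (fun s _ => hE s) (fun s _ => hf s)
    (Continuous.intervalIntegrable (by fun_prop) _ _) (hf'.intervalIntegrable _ _), hp]
  have e : Complex.exp (-(Complex.I * n * ((2 * π : ℝ) : ℂ))) = 1 := by
    rw [Complex.exp_eq_one_iff]
    refine ⟨-n, ?_⟩
    push_cast
    ring
  rw [e]
  simp_rw [mul_assoc, intervalIntegral.integral_const_mul]
  simp [mul_assoc]

/-- Two integrations by parts give `O(1/n²)`. The constant `r + r²` depends on `x`, so this serves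
only for pointwise convergence. -/
theorem summable_fourierCoeff_phase (ε : ℤˣ) (p : ℝ) (x : ℂ) :
    Summable (fourierCoeff (phase ε p x)) := by
  obtain ⟨r, β, hr, hβ⟩ := exists_phase_eq_cis ε p x
  set H : ℝ → ℂ := cis (cosPhase r β 0)
  have c0 : Continuous H := continuous_cis (continuous_cosPhase r β 0)
  set d : ℝ → ℂ := fun s => Complex.I * ((r * Real.sin (β - s) + 0 : ℝ) : ℂ) with hd
  have cd : Continuous d := by fun_prop
  set d' : ℝ → ℂ := fun s => Complex.I * ((-(r * Real.cos (β - s)) : ℝ) : ℂ) with hd'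
  have cd' : Continuous d' := by fun_prop
  have hH : ∀ s, HasDerivAt H (d s * H s) s := fun s => hasDerivAt_cis (hasDerivAt_cosPhase r β 0 s)
  have hH' : ∀ s, HasDerivAt (fun s => d s * H s) (d' s * H s + d s * (d s * H s)) s := fun s =>
    (((hasDerivAt_cosPhase_deriv r β 0 s).ofReal_comp).const_mul Complex.I).fun_mul (hH s)
  have p0 : H (2 * π) = H 0 := by
    simp only [H, cis, cosPhase, Real.cos_sub_two_pi]
    simp
  have p1 : d (2 * π) * H (2 * π) = d 0 * H 0 := by
    rw [p0]
    simp only [hd, Real.sin_sub_two_pi]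
    simp
  have key : ∀ n : ℤ, n ≠ 0 → ‖fourierCoeff (phase ε p x) n‖ ≤ (r + r * r) * (1 / (n : ℝ) ^ 2) := by
    intro n hn
    have e1 := integral_exp_mul_deriv hH (cd.mul c0) p0 n
    have e2 := integral_exp_mul_deriv hH' (by fun_prop) p1 n
    rw [e1] at e2
    have e3 : fourierCoeff (phase ε p x) n = (1 / (2 * π) : ℝ) •
        ∫ s in (0 : ℝ)..2 * π, Complex.exp (-(Complex.I * n * s)) * H s := by
      rw [fourierCoeff_eq_intervalIntegral _ n 0, zero_add]
      congr 1
      refine intervalIntegral.integral_congr fun s _ => ?_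
      simp only [smul_eq_mul]
      rw [hβ, fourier_coe_two_pi]
      push_cast
      ring_nf
    have b : ‖∫ s in (0 : ℝ)..2 * π, Complex.exp (-(Complex.I * n * s)) *
        (d' s * H s + d s * (d s * H s))‖ ≤ (r + r * r) * (2 * π) := by
      have hb := intervalIntegral.norm_integral_le_of_norm_le_const (a := 0) (b := 2 * π)
        (C := r + r * r)
        (f := fun s => Complex.exp (-(Complex.I * n * s)) * (d' s * H s + d s * (d s * H s)))
        fun s _ => by
          have hd1 : ‖d s‖ ≤ r := by
            rw [hd, norm_mul, Complex.norm_I, Complex.norm_real, Real.norm_eq_abs, one_mul,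
              add_zero, abs_mul, abs_of_nonneg hr]
            exact mul_le_of_le_one_right hr (Real.abs_sin_le_one _)
          have hd2 : ‖d' s‖ ≤ r := by
            rw [hd', norm_mul, Complex.norm_I, Complex.norm_real, Real.norm_eq_abs, one_mul,
              abs_neg, abs_mul, abs_of_nonneg hr]
            exact mul_le_of_le_one_right hr (Real.abs_cos_le_one _)
          have hE : ‖Complex.exp (-(Complex.I * n * s))‖ = 1 := by
            rw [show -(Complex.I * n * s) = ((-(n * s) : ℝ) : ℂ) * Complex.I by push_cast; ring]
            exact Complex.norm_exp_ofReal_mul_I _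
          have hHn : ‖H s‖ = 1 := norm_cis _ _
          rw [norm_mul, hE, one_mul]
          refine (norm_add_le _ _).trans ?_
          rw [norm_mul (d' s), norm_mul (d s), norm_mul (d s), hHn, mul_one, mul_one]
          gcongr
      rwa [sub_zero, abs_of_pos Real.two_pi_pos] at hb
    rw [e2, ← mul_assoc, norm_mul, norm_mul, norm_mul, Complex.norm_I, one_mul,
      Complex.norm_intCast] at b
    rw [e3, norm_smul, Real.norm_eq_abs, abs_of_pos (by positivity)]
    have hn2 : (0 : ℝ) < (n : ℝ) ^ 2 := by positivity
    have hn3 : |(n : ℝ)| * |(n : ℝ)| = (n : ℝ) ^ 2 := by rw [← sq, sq_abs]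
    rw [hn3] at b
    rw [mul_one_div, le_div_iff₀ hn2, one_div_mul_eq_div, div_mul_eq_mul_div,
      div_le_iff₀ Real.two_pi_pos]
    linarith
  refine Summable.of_norm_bounded_eventually
    ((Real.summable_one_div_int_pow.2 one_lt_two).mul_left (r + r * r)) ?_
  filter_upwards [(Set.finite_singleton (0 : ℤ)).compl_mem_cofinite] with n hn
  exact key n hn

theorem hasSum_fourierCoeff_phase (ε : ℤˣ) (p : ℝ) (x : ℂ) (φ : Angle) :
    HasSum (fun j => fourierCoeff (phase ε p x) j • fourier j φ) (phase ε p x φ) :=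
  has_pointwise_sum_fourier_series_of_summable (f := ⟨phase ε p x, continuous_phase ε p x⟩)
    (summable_fourierCoeff_phase ε p x) φ

/-! ### Matrix entries of the operator transform and the inner series. -/

theorem phase_inv_trans (ε : ℤˣ) (p : ℝ) (g : SE2) (α : Angle) :
    phase ε p (g⁻¹).trans α = phase ε p (-g.trans) (α + g.ang) := by
  have h : unitVec (-g.ang) = conj (unitVec g.ang) := by
    rw [unitVec, unitVec, AddCircle.toCircle_neg, Circle.coe_inv_eq_conj]
  rw [phase, phase, SE2.inv_trans, h, SE2.unitVec_add]
  congr 4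
  simp
  ring

theorem continuous_phase_uncurry (ε : ℤˣ) (p : ℝ) :
    Continuous fun q : ℂ × Angle => phase ε p q.1 q.2 := by
  have h : Continuous unitVec := continuous_subtype_val.comp AddCircle.continuous_toCircle
  have h1 : Continuous fun q : ℂ × Angle => (unitVec q.2).re :=
    Complex.continuous_re.comp (h.comp continuous_snd)
  have h2 : Continuous fun q : ℂ × Angle => (unitVec q.2).im :=
    Complex.continuous_im.comp (h.comp continuous_snd)
  have h3 : Continuous fun q : ℂ × Angle => q.1.re := Complex.continuous_re.comp continuous_fst
  have h4 : Continuous fun q : ℂ × Angle => q.1.im := Complex.continuous_im.comp continuous_fst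
  unfold phase
  fun_prop

theorem measurable_toProd : Measurable fun g : SE2 => (g.trans, g.ang) := comap_measurable _

/-- The function `α ↦ e^{-iεp⟨u_{α+θ}, x⟩} e^{in(α+θ)}`, as a continuous function on the circle that
depends continuously on `(x, θ)`. -/
noncomputable def waveMap (ε : ℤˣ) (p : ℝ) (n : ℤ) : C(ℂ × Angle, C(Angle, ℂ)) :=
  ContinuousMap.curry ⟨fun q : (ℂ × Angle) × Angle =>
    phase ε p (-q.1.1) (q.2 + q.1.2) * fourier n (q.2 + q.1.2), by
      have h : Continuous fun q : (ℂ × Angle) × Angle => phase ε p (-q.1.1) (q.2 + q.1.2) :=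
        (continuous_phase_uncurry ε p).comp
          (f := fun q : (ℂ × Angle) × Angle => (-q.1.1, q.2 + q.1.2)) (by fun_prop)
      fun_prop⟩

theorem waveMap_apply (ε : ℤˣ) (p : ℝ) (n : ℤ) (q : ℂ × Angle) (α : Angle) :
    waveMap ε p n q α = phase ε p (-q.1) (α + q.2) * fourier n (α + q.2) := rfl

/-- Factoring the orbit of a basis vector through a continuous map into the continuous functions
gives the strong measurability behind the operator integral. -/
theorem repr_inv_fourierLp (ε : ℤˣ) (p : ℝ) (n : ℤ) (g : SE2) :
    repr ε p g⁻¹ (fourierLp 2 n) =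
      ContinuousMap.toLp 2 AddCircle.haarAddCircle ℂ (waveMap ε p n (g.trans, g.ang)) := by
  apply Lp.ext
  refine (MemLp.coeFn_toLp _).trans
    (Filter.EventuallyEq.trans ?_ (ContinuousMap.coeFn_toLp _ _).symm)
  have h := (measurePreserving_sub_right (AddCircle.haarAddCircle (T := 2 * π))
    (g⁻¹).ang).quasiMeasurePreserving.ae (coeFn_fourierLp 2 n)
  filter_upwards [h] with α hα
  rw [hα, waveMap_apply, phase_inv_trans, SE2.inv_ang, sub_neg_eq_add]

/-- Translating the circle variable by the rotation angle leaves one Fourier coefficient of a plane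
wave. -/
theorem inner_waveMap (ε : ℤˣ) (p : ℝ) (n m : ℤ) (q : ℂ × Angle) :
    inner ℂ (fourierLp (T := 2 * π) 2 m)
      (ContinuousMap.toLp 2 AddCircle.haarAddCircle ℂ (waveMap ε p n q)) =
      fourier m q.2 * fourierCoeff (phase ε p (-q.1)) (m - n) := by
  rw [fourierLp, ContinuousMap.inner_toLp, fourierCoeff, ← integral_const_mul]
  rw [← integral_add_right_eq_self (μ := AddCircle.haarAddCircle (T := 2 * π))
    (fun β => fourier m q.2 * (fourier (-(m - n)) β • phase ε p (-q.1) β)) q.2]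
  refine integral_congr_ae (Filter.Eventually.of_forall fun α => ?_)
  have e1 : conj (fourier m α) = fourier m q.2 * fourier (-m) (α + q.2) := by
    rw [← fourier_neg]
    simp only [fourier_apply, neg_smul, smul_add, AddCircle.toCircle_add,
      AddCircle.toCircle_neg, Circle.coe_mul, Circle.coe_inv]
    have := Circle.coe_ne_zero (AddCircle.toCircle (m • q.2))
    field_simp
  have e2 : (fourier (-(m - n)) (α + q.2) : ℂ) = fourier (-m) (α + q.2) * fourier n (α + q.2) := by
    rw [← fourier_add, show -(m - n) = -m + n by ring]
  simp only [smul_eq_mul, waveMap_apply]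
  rw [e1, e2]
  ring

theorem integrable_smul_repr {c : ℝ} {f : SE2 → ℂ} (hf : Integrable f (haar c)) (ε : ℤˣ) (p : ℝ)
    (n : ℤ) : Integrable (fun g => f g • repr ε p g⁻¹ (fourierLp 2 n)) (haar c) := by
  simp_rw [repr_inv_fourierLp]
  set L := ContinuousMap.toLp (E := ℂ) 2 (AddCircle.haarAddCircle (T := 2 * π)) ℂ
  have hm : StronglyMeasurable fun g : SE2 => L (waveMap ε p n (g.trans, g.ang)) :=
    (L.continuous.comp (waveMap ε p n).continuous).stronglyMeasurable.comp_measurable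
      measurable_toProd
  refine (hf.norm.mul_const ‖L‖).mono' (hf.1.smul hm.aestronglyMeasurable)
    (Filter.Eventually.of_forall fun g => ?_)
  rw [norm_smul]
  refine mul_le_mul_of_nonneg_left ?_ (norm_nonneg _)
  refine (L.le_opNorm _).trans (mul_le_of_le_one_right (norm_nonneg _) ?_)
  refine (ContinuousMap.norm_le _ zero_le_one).2 fun α => ?_
  rw [waveMap_apply, norm_mul, norm_phase, one_mul, fourier_apply, Circle.norm_coe]

theorem inner_smul_repr (ε : ℤˣ) (p : ℝ) (n m : ℤ) (a : ℂ) (g : SE2) :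
    inner ℂ (fourierLp (T := 2 * π) 2 m) (a • repr ε p g⁻¹ (fourierLp 2 n)) =
      a * (fourier m g.ang * fourierCoeff (phase ε p (-g.trans)) (m - n)) := by
  rw [inner_smul_right, repr_inv_fourierLp, inner_waveMap]

theorem integrable_entry {c : ℝ} {f : SE2 → ℂ} (hf : Integrable f (haar c)) (ε : ℤˣ) (p : ℝ)
    (n m : ℤ) : Integrable (fun g => f g * (fourier m g.ang *
      fourierCoeff (phase ε p (-g.trans)) (m - n))) (haar c) := by
  have := (integrable_smul_repr hf ε p n).const_inner (𝕜 := ℂ) (fourierLp (T := 2 * π) 2 m)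
  simpa only [inner_smul_repr] using this

theorem opEntry_eq {c : ℝ} {f : SE2 → ℂ} (hf : Integrable f (haar c)) (ε : ℤˣ) (p : ℝ) (n m : ℤ) :
    opEntry ε c f p n m = ∫ g, f g * (fourier m g.ang *
      fourierCoeff (phase ε p (-g.trans)) (m - n)) ∂(haar c) := by
  rw [opEntry, opFourier, ← integral_inner (integrable_smul_repr hf ε p n)]
  simp only [inner_smul_repr]

/-- At the angle `Φ` one has `ρ u_Φ = (k₁, k₂)`, so the plane wave becomes a lattice character. -/
theorem phase_Phi (ε : ℤˣ) (κ : ℤ × ℤ) (k : ℤ) (g : SE2) :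
    fourier k g.ang * phase ε (2 * π * rho κ) (-g.trans) (Phi κ : ℝ) =
      conj (basisLift (ε * κ.1) (ε * κ.2) (-k) g) := by
  have u1 : (unitVec (Phi κ : Angle)).re = Real.cos (Phi κ) := by
    rw [SE2.unitVec_coe]; simp [-Complex.ofReal_cos, -Complex.ofReal_sin]
  have u2 : (unitVec (Phi κ : Angle)).im = Real.sin (Phi κ) := by
    rw [SE2.unitVec_coe]; simp [-Complex.ofReal_cos, -Complex.ofReal_sin]
  rw [basisLift, map_mul, ← fourier_neg, neg_neg, mul_comm, ← Complex.exp_conj, phase, u1, u2]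
  congr 2
  have e : ((ε : ℤ) : ℝ) * (2 * π * rho κ) *
      (Real.cos (Phi κ) * (-g.trans).re + Real.sin (Phi κ) * (-g.trans).im) =
      -(2 * π * ((ε : ℤ) * κ.1 * g.trans.re + (ε : ℤ) * κ.2 * g.trans.im)) := by
    rw [← rho_mul_cos_Phi, ← rho_mul_sin_Phi, Complex.neg_re, Complex.neg_im]
    ring
  rw [e]
  simp [map_ofNat (starRingEnd ℂ)]
  ring

/-- The inner series converges to a Fourier coefficient of `f` over `ℤ² \ SE(2)`. -/
theorem hasSum_innerTerm {c : ℝ} {f : SE2 → ℂ} (hf : Integrable f (haar c)) (ε : ℤˣ) (κ : ℤ × ℤ)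
    (k : ℤ) :
    HasSum (fun n : ℤ => innerTerm ε c f κ k n)
      (∫ g, f g * conj (basisLift (ε * κ.1) (ε * κ.2) (-k) g) ∂(haar c))
      (SummationFilter.conditional ℤ) := by
  set p := 2 * π * rho κ with hp
  set t : SE2 → ℤ → ℂ := fun g j =>
    fourierCoeff (phase ε p (-g.trans)) j • fourier j (Phi κ : Angle) with ht
  have hterm : ∀ n, innerTerm ε c f κ k n =
      ∫ g, f g * (fourier k g.ang * t g (k - n)) ∂(haar c) := fun n => by
    rw [innerTerm, opEntry_eq hf, ← integral_const_mul]
    refine integral_congr_ae (Filter.Eventually.of_forall fun g => ?_)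
    simp only [ht, smul_eq_mul]
    rw [fourier_coe_two_pi (k - n) (Phi κ)]
    push_cast
    ring
  have hint : ∀ n, Integrable (fun g => f g * (fourier k g.ang * t g (k - n))) (haar c) := fun n => by
    have := (integrable_entry hf ε p n k).mul_const (fourier (k - n) (Phi κ : Angle) : ℂ)
    refine this.congr (Filter.Eventually.of_forall fun g => ?_)
    simp only [ht, smul_eq_mul]
    ring
  rw [HasSum, SummationFilter.conditional_filter, Filter.tendsto_map'_iff]
  have hsum : ∀ s : Finset ℤ, ∑ n ∈ s, innerTerm ε c f κ k n =
      ∫ g, f g * (fourier k g.ang * ∑ n ∈ s, t g (k - n)) ∂(haar c) := fun s => by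
    simp_rw [hterm, Finset.mul_sum]
    rw [integral_finsetSum _ fun n _ => hint n]
  simp only [Function.comp_def, hsum]
  -- The majorant is the uniform bound for partial sums; it holds for intervals of integers, hence
  -- the conditional summation.
  refine tendsto_integral_filter_of_dominated_convergence (fun g => ‖f g‖ * 3672)
    (Filter.Eventually.of_forall fun q => ?_) (Filter.Eventually.of_forall fun q =>
      Filter.Eventually.of_forall fun g => ?_) (hf.norm.mul_const _)
    (Filter.Eventually.of_forall fun g => ?_)
  · simp_rw [Finset.mul_sum]
    exact (integrable_finsetSum _ fun n _ => hint n).1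
  · rw [norm_mul, norm_mul, fourier_apply, Circle.norm_coe, one_mul]
    refine mul_le_mul_of_nonneg_left ?_ (norm_nonneg _)
    -- The reflection `n ↦ k - n` maps intervals to intervals.
    have e : ∑ n ∈ Finset.Icc q.1 q.2, t g (k - n) =
        ∑ j ∈ Finset.Icc (k - q.2) (k - q.1), t g j := by
      refine Finset.sum_nbij' (fun n => k - n) (fun n => k - n) ?_ ?_ ?_ ?_ ?_
      all_goals intro n hn
      all_goals simp only [Finset.mem_Icc] at *
      all_goals omega
    rw [e]
    exact norm_sum_fourierCoeff_phase_le ε p (-g.trans) _ _ _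
  · rw [← phase_Phi]
    refine (Filter.Tendsto.const_mul _ (Filter.Tendsto.const_mul _ ?_))
    have h := (Equiv.subLeft k).hasSum_iff.2 (hasSum_fourierCoeff_phase ε p (-g.trans) (Phi κ))
    have h2 : Filter.Tendsto (fun q : ℤ × ℤ => Finset.Icc q.1 q.2) (Filter.atBot ×ˢ Filter.atTop)
        Filter.atTop := by
      have := SummationFilter.LeAtTop.le_atTop (L := SummationFilter.conditional ℤ)
      rwa [SummationFilter.conditional_filter] at this
    rw [HasSum] at h
    exact h.comp h2

theorem charCoeff_eq (c : ℝ) (f : SE2 → ℂ) (k : ℤ) :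
    charCoeff c f k = ∫ g, f g * conj (basisLift 0 0 k g) ∂(haar c) := by
  simp [charCoeff, chi, basisLift]

/-- A countable sum of measurable complex functions is measurable. -/
theorem measurable_tsum_complex {ι X : Type*} [Countable ι] [MeasurableSpace X] {u : ι → X → ℂ}
    (hu : ∀ i, Measurable (u i)) : Measurable fun x => ∑' i, u i x := by
  set A : Set X := {x | ∑' i, ‖u i x‖ₑ ≠ ∞} with hA
  have hAm : MeasurableSet A :=
    (Measurable.tsum fun i => (hu i).enorm) (measurableSet_singleton ∞).compl
  have hiff : ∀ x, x ∈ A ↔ Summable fun i => u i x := fun x => by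
    rw [← summable_norm_iff]
    exact ENNReal.tsum_coe_ne_top_iff_summable.trans
      (NNReal.summable_coe (f := fun i => ‖u i x‖₊)).symm
  refine measurable_of_tendsto_metrizable' (Filter.atTop : Filter (Finset ι))
    (f := fun s => A.indicator fun x => ∑ i ∈ s, u i x)
    (fun s => (Finset.measurable_fun_sum s fun i _ => hu i).indicator hAm)
    (tendsto_pi_nhds.2 fun x => ?_)
  by_cases hx : x ∈ A
  · simp only [Set.indicator_of_mem hx]
    exact ((hiff x).1 hx).hasSum
  · simp only [Set.indicator_of_notMem hx]
    rw [tsum_eq_zero_of_not_summable (mt (hiff x).2 hx)]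
    exact tendsto_const_nhds

/-! ### The fundamental domain and its parametrization by a torus. -/

theorem measurable_trans : Measurable fun g : SE2 => g.trans := measurable_fst.comp measurable_toProd

theorem measurable_ang : Measurable fun g : SE2 => g.ang := measurable_snd.comp measurable_toProd

theorem measurable_mk {X : Type*} [MeasurableSpace X] {a : X → ℂ} {b : X → Angle}
    (ha : Measurable a) (hb : Measurable b) : Measurable fun x => (⟨a x, b x⟩ : SE2) :=
  measurable_comap_iff.2 (ha.prodMk hb)

theorem measurable_coset : Measurable coset := measurable_quotient_mk''

theorem measurable_basisLift (k₁ k₂ k₃ : ℤ) : Measurable (basisLift k₁ k₂ k₃) :=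
  (measurable_psi k₁ k₂ k₃).comp measurable_coset

theorem norm_basisLift (k₁ k₂ k₃ : ℤ) (g : SE2) : ‖basisLift k₁ k₂ k₃ g‖ = 1 :=
  norm_psi k₁ k₂ k₃ (coset g)

/-- The lattice element with coordinates `m`, `n`. -/
noncomputable def latticePoint (q : ℤ × ℤ) : lattice := ⟨⟨⟨q.1, q.2⟩, 0⟩, rfl, q.1, q.2, rfl⟩

theorem latticePoint_surjective : Function.Surjective latticePoint := by
  rintro ⟨g, hg, m, n, h⟩
  exact ⟨(m, n), Subtype.ext (SE2.ext h.symm hg.symm)⟩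

instance : Countable lattice := latticePoint_surjective.countable

theorem latticePoint_smul (q : ℤ × ℤ) (g : SE2) :
    latticePoint q • g = ⟨⟨q.1 + g.trans.re, q.2 + g.trans.im⟩, g.ang⟩ := by
  change (latticePoint q : SE2) * g = _
  ext
  · rw [SE2.mul_trans]
    simp [latticePoint, SE2.unitVec_zero, Complex.ext_iff]
  · simp [latticePoint]

/-- The half-open unit square. -/
def unitBox : Set ℂ := {z | z.re ∈ Set.Ioc (0 : ℝ) 1 ∧ z.im ∈ Set.Ioc (0 : ℝ) 1}

theorem measurableSet_unitBox : MeasurableSet unitBox :=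
  (Complex.measurable_re measurableSet_Ioc).inter (Complex.measurable_im measurableSet_Ioc)

/-- A strict fundamental domain for the lattice. -/
def fundDomain : Set SE2 := {g | g.trans ∈ unitBox}

theorem measurableSet_fundDomain : MeasurableSet fundDomain :=
  measurable_trans measurableSet_unitBox

theorem existsUnique_smul_mem_fundDomain (g : SE2) : ∃! γ : lattice, γ • g ∈ fundDomain := by
  obtain ⟨m, hm, hm'⟩ := existsUnique_add_zsmul_mem_Ioc one_pos g.trans.re 0
  obtain ⟨n, hn, hn'⟩ := existsUnique_add_zsmul_mem_Ioc one_pos g.trans.im 0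
  simp only [zsmul_eq_mul, mul_one, zero_add] at hm hm' hn hn'
  refine ⟨latticePoint (m, n), ?_, fun γ hγ => ?_⟩
  · simp only [latticePoint_smul]
    exact ⟨by rwa [add_comm] at hm, by rwa [add_comm] at hn⟩
  · obtain ⟨q, rfl⟩ := latticePoint_surjective γ
    simp only [latticePoint_smul] at hγ
    rw [← hm' q.1 (by rw [add_comm]; exact hγ.1), ← hn' q.2 (by rw [add_comm]; exact hγ.2)]

theorem measurable_smul_lattice (γ : lattice) : Measurable fun g : SE2 => γ • g := by
  obtain ⟨q, rfl⟩ := latticePoint_surjective γ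
  have h : (fun g : SE2 => latticePoint q • g) = fun g =>
      ⟨(⟨q.1, q.2⟩ : ℂ) + g.trans, g.ang⟩ := by
    funext g
    rw [latticePoint_smul]
    rfl
  rw [h]
  exact measurable_mk (measurable_trans.const_add _) measurable_ang

theorem measurePreserving_smul_lattice (c : ℝ) (γ : lattice) :
    MeasurePreserving (fun g : SE2 => γ • g) (haar c) (haar c) := by
  refine MeasurePreserving.smul_measure ⟨measurable_smul_lattice γ, ?_⟩ _
  have hmk : Measurable fun q : ℂ × Angle => (⟨q.1, q.2⟩ : SE2) :=
    measurable_mk measurable_fst measurable_snd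
  obtain ⟨q, rfl⟩ := latticePoint_surjective γ
  rw [Measure.map_map (measurable_smul_lattice _) hmk]
  have h := ((measurePreserving_add_left (volume : Measure ℂ) (⟨q.1, q.2⟩ : ℂ)).prod
    (MeasurePreserving.id (volume : Measure Angle)))
  conv_rhs => rw [← h.map_eq, Measure.map_map hmk h.measurable]
  congr 1
  funext r
  simp only [Function.comp_apply, latticePoint_smul]
  rfl

theorem coset_eq_coset_iff {g h : SE2} : coset g = coset h ↔ ∃ γ : lattice, γ • h = g :=
  Quotient.eq (r := MulAction.orbitRel lattice SE2)

theorem periodize_coset {M : Type*} [TopologicalSpace M] [AddCommMonoid M] [T2Space M]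
    (f : SE2 → M) (g : SE2) : periodize f (coset g) = ∑' γ : lattice, f (γ • g) := rfl

/-- The representative of a point of the unit circle in `(0, 1]`. -/
noncomputable def circleRep (t : UnitAddCircle) : ℝ := AddCircle.equivIoc 1 0 t

theorem coe_circleRep (t : UnitAddCircle) : (circleRep t : UnitAddCircle) = t :=
  (AddCircle.equivIoc (1 : ℝ) 0).symm_apply_apply t

theorem haarAddCircle_one : AddCircle.haarAddCircle = (volume : Measure UnitAddCircle) := by
  simp [volume, AddCircle.haarAddCircle]

theorem measurePreserving_circleRep :
    MeasurePreserving circleRep (AddCircle.haarAddCircle (T := 1))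
      (volume.restrict (Set.Ioc (0 : ℝ) 1)) := by
  rw [haarAddCircle_one]
  have h := AddCircle.measurePreserving_equivIoc (1 : ℝ) (a := 0)
  have h2 : MeasurePreserving (Subtype.val : Set.Ioc (0 : ℝ) (0 + 1) → ℝ)
      (Measure.comap Subtype.val volume) (volume.restrict (Set.Ioc (0 : ℝ) (0 + 1))) :=
    ⟨measurable_subtype_coe, map_comap_subtype_coe measurableSet_Ioc _⟩
  rw [show Set.Ioc (0 : ℝ) 1 = Set.Ioc 0 (0 + 1) by rw [zero_add]]
  exact h2.comp h

/-- The rescaling `ℝ/ℤ → ℝ/2πℤ`. -/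
noncomputable def circleScale : UnitAddCircle ≃ₜ Angle :=
  AddCircle.homeomorphAddCircle 1 (2 * π) one_ne_zero Real.two_pi_pos.ne'

theorem measurePreserving_circleScale :
    MeasurePreserving circleScale (AddCircle.haarAddCircle (T := 1))
      (AddCircle.haarAddCircle (T := 2 * π)) :=
  AddMonoidHom.measurePreserving
    (f := (AddCircle.equivAddCircle 1 (2 * π) one_ne_zero Real.two_pi_pos.ne').toAddMonoidHom)
    circleScale.continuous circleScale.surjective (by simp)

theorem fourier_circleScale (n : ℤ) (t : UnitAddCircle) :
    (fourier n (circleScale t) : ℂ) = fourier n t := by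
  induction t using QuotientAddGroup.induction_on with | _ t => ?_
  change (fourier n (AddCircle.homeomorphAddCircle 1 (2 * π) one_ne_zero Real.two_pi_pos.ne'
    (t : AddCircle (1 : ℝ))) : ℂ) = fourier n (t : AddCircle (1 : ℝ))
  rw [AddCircle.homeomorphAddCircle_apply_mk, fourier_coe_two_pi, fourier_coe_apply]
  congr 1
  push_cast
  ring

/-- The section of the projection of `SE(2)` on the three dimensional torus. -/
noncomputable def torusSection (t : UnitAddTorus (Fin 3)) : SE2 :=
  ⟨⟨circleRep (t 0), circleRep (t 1)⟩, circleScale (t 2)⟩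

/-- The Haar probability measure of the three dimensional torus. -/
noncomputable def torusMeasure : Measure (UnitAddTorus (Fin 3)) :=
  Measure.pi fun _ => AddCircle.haarAddCircle

theorem measurePreserving_torusSection :
    MeasurePreserving torusSection torusMeasure
      (Measure.map (fun q : ℂ × Angle => (⟨q.1, q.2⟩ : SE2))
        ((volume.restrict unitBox).prod AddCircle.haarAddCircle)) := by
  have hmk : Measurable fun q : ℂ × Angle => (⟨q.1, q.2⟩ : SE2) :=
    measurable_mk measurable_fst measurable_snd
  have h1 := measurePreserving_piFinSuccAbove
    (fun _ : Fin 3 => AddCircle.haarAddCircle (T := (1 : ℝ))) 2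
  have h2 := measurePreserving_finTwoArrow (AddCircle.haarAddCircle (T := (1 : ℝ)))
  have h3 := measurePreserving_circleRep.prod measurePreserving_circleRep
  have h4 : MeasurePreserving Complex.measurableEquivRealProd.symm
      ((volume.restrict (Set.Ioc (0 : ℝ) 1)).prod (volume.restrict (Set.Ioc (0 : ℝ) 1)))
      (volume.restrict unitBox) := by
    have := (Complex.volume_preserving_equiv_real_prod.symm).restrict_preimage
      measurableSet_unitBox
    rw [Measure.prod_restrict]
    exact this
  have h5 := (measurePreserving_circleScale.prod ((h4.comp h3).comp h2)).comp h1
  have h6 := (Measure.measurePreserving_swap).comp h5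
  exact (hmk.measurePreserving _).comp h6

/-- The factor `2π` is the total length of the angle circle, the torus having total mass one. -/
theorem haar_restrict_fundDomain (c : ℝ) :
    (haar c).restrict fundDomain =
      (ENNReal.ofReal c * ENNReal.ofReal (2 * π)) • Measure.map torusSection torusMeasure := by
  have hmk : Measurable fun q : ℂ × Angle => (⟨q.1, q.2⟩ : SE2) :=
    measurable_mk measurable_fst measurable_snd
  have e : (fun q : ℂ × Angle => (⟨q.1, q.2⟩ : SE2)) ⁻¹' fundDomain = unitBox ×ˢ Set.univ := by
    ext q
    simp [fundDomain]
  rw [measurePreserving_torusSection.map_eq, haar, Measure.restrict_smul,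
    Measure.restrict_map hmk measurableSet_fundDomain, e, ← Measure.prod_restrict,
    Measure.restrict_univ, AddCircle.volume_eq_smul_haarAddCircle, Measure.prod_smul_right,
    Measure.map_smul, mul_smul]

theorem periodize_indicator (E : Set CosetSpace) (q : CosetSpace) :
    periodize ((coset ⁻¹' E ∩ fundDomain).indicator fun _ => (1 : ℂ)) q =
      E.indicator (fun _ => (1 : ℂ)) q := by
  classical
  induction q using Quotient.inductionOn with | h g => ?_
  change periodize _ (coset g) = E.indicator _ (coset g)
  obtain ⟨γ, hγ, huniq⟩ := existsUnique_smul_mem_fundDomain g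
  have hc : ∀ δ : lattice, coset (δ • g) = coset g := fun δ => coset_eq_coset_iff.2 ⟨δ, rfl⟩
  rw [periodize_coset, tsum_eq_single γ]
  · simp only [Set.indicator_apply, Set.mem_inter_iff, Set.mem_preimage, hc]
    congr 1
    exact propext (and_iff_left hγ)
  · intro δ hδ
    exact Set.indicator_of_notMem (fun h => hδ (huniq δ h.2)) _

instance : IsProbabilityMeasure torusMeasure := by
  unfold torusMeasure; infer_instance

instance (c : ℝ) : IsFiniteMeasure ((haar c).restrict fundDomain) := by
  rw [haar_restrict_fundDomain]
  have : IsProbabilityMeasure (Measure.map torusSection torusMeasure) :=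
    Measure.isProbabilityMeasure_map measurePreserving_torusSection.aemeasurable
  exact Measure.smul_finite _ (by finiteness)

/-! ### The measure on the coset space and the orthogonal expansion. -/

section

variable {c : ℝ} {μ : Measure CosetSpace}

/-- Weil's formula is applied to the indicator of the part of a saturated set in the fundamental
domain; its periodization is the indicator downstairs. -/
theorem IsNormalizedInvariant.eq_map [IsFiniteMeasure μ] (hμ : IsNormalizedInvariant c μ) :
    μ = ((haar c).restrict fundDomain).map coset := by
  ext E hE
  have hS : MeasurableSet (coset ⁻¹' E ∩ fundDomain) :=
    (measurable_coset hE).inter measurableSet_fundDomain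
  have hfin : haar c (coset ⁻¹' E ∩ fundDomain) ≠ ∞ := by
    rw [← Measure.restrict_apply (measurable_coset hE)]
    exact measure_ne_top _ _
  have h := hμ.weil ((coset ⁻¹' E ∩ fundDomain).indicator fun _ => (1 : ℂ))
    ((integrable_indicator_iff hS).2 (integrableOn_const hfin))
  simp_rw [periodize_indicator] at h
  rw [integral_indicator hE, integral_indicator hS, setIntegral_const, setIntegral_const] at h
  have h2 : μ.real E = (haar c).real (coset ⁻¹' E ∩ fundDomain) := by
    have := congrArg Complex.re h
    simpa using this
  rw [Measure.map_apply measurable_coset hE, Measure.restrict_apply (measurable_coset hE)]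
  exact (ENNReal.toReal_eq_toReal_iff' (measure_ne_top _ _) hfin).1 h2

/-- Properties that hold almost everywhere on `SE(2)` hold on almost all whole cosets. -/
theorem IsNormalizedInvariant.ae_forall_coset [IsFiniteMeasure μ]
    (hμ : IsNormalizedInvariant c μ) {P : SE2 → Prop}
    (hP : ∀ᵐ g ∂(haar c), P g) : ∀ᵐ q ∂μ, ∀ g, coset g = q → P g := by
  set N := toMeasurable (haar c) {g | ¬ P g}
  -- The saturation of the exceptional set is still null, since the lattice is countable and
  -- preserves the measure.
  set N' : Set SE2 := ⋃ γ : lattice, (fun g : SE2 => γ • g) ⁻¹' N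
  have hN' : MeasurableSet N' := MeasurableSet.iUnion fun γ =>
    measurable_smul_lattice γ (measurableSet_toMeasurable _ _)
  have hnull : haar c N' = 0 := by
    refine measure_iUnion_null fun γ => ?_
    rw [(measurePreserving_smul_lattice c γ).measure_preimage
      (measurableSet_toMeasurable _ _).nullMeasurableSet, measure_toMeasurable]
    exact hP
  have hpre : coset ⁻¹' (coset '' N') = N' := by
    refine Set.Subset.antisymm ?_ (Set.subset_preimage_image _ _)
    rintro g ⟨n, hn, hng⟩
    obtain ⟨γ, rfl⟩ := coset_eq_coset_iff.1 hng
    obtain ⟨δ, hδ⟩ := Set.mem_iUnion.1 hn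
    exact Set.mem_iUnion.2 ⟨δ * γ, by simpa [mul_smul] using hδ⟩
  have hQ : MeasurableSet (coset '' N') := measurableSet_quotient.2 (by
    change MeasurableSet (coset ⁻¹' (coset '' N'))
    rwa [hpre])
  have hQ0 : μ (coset '' N') = 0 := by
    rw [hμ.eq_map, Measure.map_apply measurable_coset hQ, hpre]
    exact nonpos_iff_eq_zero.1 ((Measure.restrict_apply_le _ _).trans hnull.le)
  refine measure_mono_null (fun q hq => ?_) hQ0
  simp only [Set.mem_compl_iff, Set.mem_ofPred_eq, not_forall] at hq
  obtain ⟨g, rfl, hg⟩ := hq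
  exact ⟨g, Set.mem_iUnion.2 ⟨1, by
    simpa using subset_toMeasurable (haar c) {g | ¬ P g} hg⟩, rfl⟩

/-- A measurable version of `f` agrees with it on almost all whole cosets, hence has almost
everywhere the same periodization. -/
theorem IsNormalizedInvariant.aestronglyMeasurable_periodize [IsFiniteMeasure μ]
    (hμ : IsNormalizedInvariant c μ) {f : SE2 → ℂ} (hf : AEStronglyMeasurable f (haar c)) :
    AEStronglyMeasurable (periodize f) μ := by
  have hm : Measurable (periodize (hf.mk f)) := by
    rw [measurable_from_quotient]
    change Measurable fun g => ∑' γ : lattice, hf.mk f (γ • g)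
    exact measurable_tsum_complex fun γ =>
      hf.stronglyMeasurable_mk.measurable.comp (measurable_smul_lattice γ)
  refine ⟨periodize (hf.mk f), hm.stronglyMeasurable, ?_⟩
  filter_upwards [hμ.ae_forall_coset hf.ae_eq_mk] with q hq
  induction q using Quotient.inductionOn with | h g => ?_
  change periodize f (coset g) = periodize (hf.mk f) (coset g)
  rw [periodize_coset, periodize_coset]
  exact tsum_congr fun γ => hq _ (coset_eq_coset_iff.2 ⟨γ, rfl⟩)

theorem norm_periodize_le (f : SE2 → ℂ) (q : CosetSpace) :
    ‖periodize f q‖ ≤ periodize (fun g => ‖f g‖) q := by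
  induction q using Quotient.inductionOn with | h g => ?_
  change ‖periodize f (coset g)‖ ≤ periodize (fun g => ‖f g‖) (coset g)
  rw [periodize_coset, periodize_coset]
  by_cases h : Summable fun γ : lattice => ‖f (γ • g)‖
  · exact norm_tsum_le_tsum_norm h
  -- Where the norms diverge both sums take the default value `0`, as summability in `ℂ` is
  -- absolute.
  · rw [tsum_eq_zero_of_not_summable h, tsum_eq_zero_of_not_summable (mt Summable.norm h), norm_zero]

theorem IsNormalizedInvariant.memLp_periodize [IsFiniteMeasure μ]
    (hμ : IsNormalizedInvariant c μ) {f : SE2 → ℂ}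
    (hf : Integrable f (haar c)) (hf₂ : MemLp (periodize fun g => ‖f g‖) 2 μ) :
    MemLp (periodize f) 2 μ :=
  hf₂.of_le (hμ.aestronglyMeasurable_periodize hf.1) (Filter.Eventually.of_forall fun q =>
    (norm_periodize_le f q).trans (le_abs_self _))

/-- The Fourier coefficients of a periodization, by Weil's formula. -/
theorem IsNormalizedInvariant.integral_periodize_mul_conj_psi (hμ : IsNormalizedInvariant c μ)
    {f : SE2 → ℂ} (hf : Integrable f (haar c)) (k₁ k₂ k₃ : ℤ) :
    ∫ q, periodize f q * conj (psi k₁ k₂ k₃ q) ∂μ =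
      ∫ g, f g * conj (basisLift k₁ k₂ k₃ g) ∂(haar c) := by
  have hint : Integrable (fun g => f g * conj (basisLift k₁ k₂ k₃ g)) (haar c) := by
    refine hf.mul_bdd (c := 1) ?_ (Filter.Eventually.of_forall fun g => ?_)
    · exact (Complex.continuous_conj.measurable.comp
        (measurable_basisLift k₁ k₂ k₃)).aestronglyMeasurable
    · rw [RCLike.norm_conj, norm_basisLift]
  rw [← hμ.weil _ hint]
  refine integral_congr_ae (Filter.Eventually.of_forall fun q => ?_)
  induction q using Quotient.inductionOn with | h g => ?_
  change periodize f (coset g) * conj (basisLift k₁ k₂ k₃ g) = periodize _ (coset g)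
  rw [periodize_coset, periodize_coset, ← tsum_mul_right]
  simp_rw [basisLift_smul]

theorem inner_psiLp [IsFiniteMeasure μ] (k₁ k₂ k₃ : ℤ) {F : CosetSpace → ℂ} (hF : MemLp F 2 μ) :
    inner ℂ (psiLp μ k₁ k₂ k₃) (hF.toLp F) = ∫ q, F q * conj (psi k₁ k₂ k₃ q) ∂μ := by
  rw [L2.inner_def]
  refine integral_congr_ae ?_
  filter_upwards [hF.coeFn_toLp, (memLp_psi μ k₁ k₂ k₃).coeFn_toLp] with q h1 h2
  rw [h1, psiLp, h2]
  rfl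

/-- The projection of the torus on the coset space. -/
noncomputable def torusProj (t : UnitAddTorus (Fin 3)) : CosetSpace := coset (torusSection t)

theorem measurable_torusProj : Measurable torusProj :=
  measurable_coset.comp measurePreserving_torusSection.measurable

theorem IsNormalizedInvariant.eq_smul_map [IsFiniteMeasure μ] (hc : 0 < c)
    (hμ : IsNormalizedInvariant c μ) :
    μ = ENNReal.ofReal (2 * π * c) • torusMeasure.map torusProj := by
  conv_lhs => rw [hμ.eq_map, haar_restrict_fundDomain, Measure.map_smul,
    Measure.map_map measurable_coset measurePreserving_torusSection.measurable]
  rw [mul_comm (2 * π), ENNReal.ofReal_mul hc.le]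
  rfl

theorem psi_torusProj (k : Fin 3 → ℤ) (t : UnitAddTorus (Fin 3)) :
    psi (k 0) (k 1) (k 2) (torusProj t) = UnitAddTorus.mFourier k t := by
  have h : ∀ (n : ℤ) (s : UnitAddCircle),
      fourier n s = Complex.exp (2 * π * Complex.I * (n * circleRep s)) := fun n s => by
    conv_lhs => rw [← coe_circleRep s]
    rw [fourier_coe_apply]
    congr 1
    push_cast
    ring
  change basisLift _ _ _ (torusSection t) = ∏ i : Fin 3, fourier (k i) (t i)
  rw [Fin.prod_univ_three, h, h, ← Complex.exp_add, basisLift, torusSection, fourier_circleScale,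
    mul_add]

theorem IsNormalizedInvariant.integral_eq [IsFiniteMeasure μ] (hc : 0 < c)
    (hμ : IsNormalizedInvariant c μ)
    {F : CosetSpace → ℂ} (hF : AEStronglyMeasurable F μ) :
    ∫ q, F q ∂μ = ((2 * π * c : ℝ) : ℂ) * ∫ t, F (torusProj t) ∂torusMeasure := by
  have hC : 0 < 2 * π * c := by positivity
  have hF' : AEStronglyMeasurable F (torusMeasure.map torusProj) := by
    rw [hμ.eq_smul_map hc] at hF
    exact hF.mono_ac (Measure.absolutelyContinuous_smul (by simpa using hC))
  conv_lhs => rw [hμ.eq_smul_map hc]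
  rw [integral_smul_measure, integral_map measurable_torusProj.aemeasurable hF',
    ENNReal.toReal_ofReal hC.le, Complex.real_smul]

theorem integral_mFourier_mul_conj (k l : Fin 3 → ℤ) :
    ∫ t, UnitAddTorus.mFourier l t * conj (UnitAddTorus.mFourier k t) ∂torusMeasure =
      if k = l then 1 else 0 := by
  classical
  have h := orthonormal_iff_ite.1 (UnitAddTorus.orthonormal_mFourier (d := Fin 3)) k l
  simp only [ContinuousMap.inner_toLp] at h
  rw [← h]
  rfl

theorem IsNormalizedInvariant.inner_psiLp_psiLp [IsFiniteMeasure μ] (hc : 0 < c)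
    (hμ : IsNormalizedInvariant c μ)
    (k l : Fin 3 → ℤ) :
    inner ℂ (psiLp μ (k 0) (k 1) (k 2)) (psiLp μ (l 0) (l 1) (l 2)) =
      if k = l then ((2 * π * c : ℝ) : ℂ) else 0 := by
  rw [psiLp.eq_def μ (l 0), inner_psiLp, hμ.integral_eq hc]
  · simp_rw [psi_torusProj]
    rw [integral_mFourier_mul_conj, mul_ite, mul_one, mul_zero]
  · exact ((measurable_psi _ _ _).mul
      (Complex.continuous_conj.measurable.comp (measurable_psi _ _ _))).aestronglyMeasurable

theorem ae_eq_zero_of_integral_mul_conj_mFourier {G : UnitAddTorus (Fin 3) → ℂ}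
    (hG : MemLp G 2 torusMeasure)
    (h0 : ∀ k, ∫ t, G t * conj (UnitAddTorus.mFourier k t) ∂torusMeasure = 0) :
    G =ᵐ[torusMeasure] 0 := by
  have aux : ∀ x, (∀ k, (UnitAddTorus.mFourierBasis (d := Fin 3)).repr x k = 0) → x = 0 :=
    fun x hx => (UnitAddTorus.mFourierBasis (d := Fin 3)).repr.injective (by
      rw [map_zero]
      ext k
      exact hx k)
  have hz : hG.toLp G = 0 := aux (hG.toLp G) fun k => by
    rw [UnitAddTorus.mFourierBasis_repr]
    refine Eq.trans (integral_congr_ae ?_) (h0 k)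
    refine hG.coeFn_toLp.mono fun t ht => ?_
    exact (congrArg (UnitAddTorus.mFourier (-k) t * ·) ht).trans
      (by rw [UnitAddTorus.mFourier_neg, mul_comm])
  have h1 := hG.coeFn_toLp
  rw [hz] at h1
  exact h1.symm.trans (Lp.coeFn_zero ℂ 2 torusMeasure)

/-- Completeness is inherited from the torus: `μ` is a positive multiple of the image measure, so
null sets and square integrability correspond. -/
theorem IsNormalizedInvariant.eq_zero_of_inner_psiLp [IsFiniteMeasure μ] (hc : 0 < c)
    (hμ : IsNormalizedInvariant c μ)
    (h : Lp ℂ 2 μ) (h0 : ∀ k : Fin 3 → ℤ, inner ℂ (psiLp μ (k 0) (k 1) (k 2)) h = 0) : h = 0 := by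
  have hC : 0 < 2 * π * c := by positivity
  have hac : torusMeasure.map torusProj ≤ (ENNReal.ofReal (2 * π * c))⁻¹ • μ := by
    conv_rhs => rw [hμ.eq_smul_map hc, smul_smul,
      ENNReal.inv_mul_cancel (by simpa using hC) ENNReal.ofReal_ne_top, one_smul]
  have hmem : MemLp h 2 (torusMeasure.map torusProj) :=
    (Lp.memLp h).of_measure_le_smul (ENNReal.inv_ne_top.2 (by simpa using hC)) hac
  have hmem' : MemLp (fun t => h (torusProj t)) 2 torusMeasure :=
    hmem.comp_of_map measurable_torusProj.aemeasurable
  have hz : (fun t => h (torusProj t)) =ᵐ[torusMeasure] 0 := by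
    refine ae_eq_zero_of_integral_mul_conj_mFourier hmem' fun k => ?_
    have h1 := h0 k
    rw [← Lp.toLp_coeFn h (Lp.memLp h), inner_psiLp, hμ.integral_eq hc] at h1
    · have h2 := (mul_eq_zero.1 h1).resolve_left (by exact_mod_cast hC.ne')
      simp_rw [psi_torusProj] at h2
      exact h2
    · exact (Lp.memLp h).1.mul (Complex.continuous_conj.measurable.comp
        (measurable_psi _ _ _)).aestronglyMeasurable
  have hz' : ∀ᵐ q ∂(torusMeasure.map torusProj), h q = 0 :=
    (ae_map_iff measurable_torusProj.aemeasurable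
      ((Lp.stronglyMeasurable h).measurable (measurableSet_singleton 0))).2 hz
  refine Lp.ext (Filter.EventuallyEq.trans ?_ (Lp.coeFn_zero ℂ 2 μ).symm)
  refine Measure.AbsolutelyContinuous.ae_le ?_ hz'
  conv_lhs => rw [hμ.eq_smul_map hc]
  exact Measure.smul_absolutelyContinuous

/-- The expansion of a square integrable function on the coset space. -/
theorem IsNormalizedInvariant.hasSum_psiLp [IsFiniteMeasure μ] (hc : 0 < c)
    (hμ : IsNormalizedInvariant c μ) (F : Lp ℂ 2 μ) :
    HasSum (fun k : Fin 3 → ℤ => (inner ℂ (psiLp μ (k 0) (k 1) (k 2)) F : ℂ) •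
      psiLp μ (k 0) (k 1) (k 2)) (((2 * π * c : ℝ) : ℂ) • F) := by
  classical
  have hC : 0 < 2 * π * c := by positivity
  have hsq : ((√(2 * π * c) : ℝ) : ℂ)⁻¹ * ((√(2 * π * c) : ℝ) : ℂ)⁻¹ *
      ((2 * π * c : ℝ) : ℂ) = 1 := by
    rw [← mul_inv, ← Complex.ofReal_mul, Real.mul_self_sqrt hC.le]
    exact inv_mul_cancel₀ (by exact_mod_cast hC.ne')
  set r : ℂ := ((√(2 * π * c) : ℝ) : ℂ)⁻¹ with hr
  have hr0 : r ≠ 0 := fun h => by simp [h] at hsq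
  have hrc : conj r = r := by rw [hr, map_inv₀, Complex.conj_ofReal]
  -- Scaling by `(2πc)^{-1/2}` makes the system orthonormal; the factor `2πc` on the left undoes
  -- both scalings.
  set v : (Fin 3 → ℤ) → Lp ℂ 2 μ := fun k => r • psiLp μ (k 0) (k 1) (k 2) with hv
  have ho : Orthonormal ℂ v := by
    rw [orthonormal_iff_ite]
    intro k l
    rw [hv, inner_smul_left, inner_smul_right, hμ.inner_psiLp_psiLp hc, hrc]
    split_ifs
    · rw [← mul_assoc, hsq]
    · simp
  have hbot : (Submodule.span ℂ (Set.range v))ᗮ = ⊥ := by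
    rw [Submodule.eq_bot_iff]
    intro h hh
    refine hμ.eq_zero_of_inner_psiLp hc h fun k => ?_
    have h1 := (Submodule.mem_orthogonal _ _).1 hh _ (Submodule.subset_span ⟨k, rfl⟩)
    rw [hv, inner_smul_left, hrc] at h1
    exact (mul_eq_zero.1 h1).resolve_left hr0
  have hsum := ((HilbertBasis.mkOfOrthogonalEqBot ho hbot).hasSum_repr F).const_smul
    ((2 * π * c : ℝ) : ℂ)
  refine hsum.congr_fun fun k => ?_
  rw [HilbertBasis.repr_apply_apply, HilbertBasis.coe_mkOfOrthogonalEqBot, hv, inner_smul_left, hrc,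
    smul_smul, smul_smul]
  congr 1
  linear_combination (-(inner ℂ (psiLp μ (k 0) (k 1) (k 2)) F : ℂ)) * hsq

end

/-! ### Reindexing and the final identity. -/

/-- Triples of integers as functions on `Fin 3`. -/
def finThreeEquiv : (ℤ × ℤ) × ℤ ≃ (Fin 3 → ℤ) where
  toFun q := ![q.1.1, q.1.2, q.2]
  invFun k := ((k 0, k 1), k 2)
  left_inv _ := rfl
  right_inv k := by funext i; fin_cases i <;> rfl

/-- The frequencies split into zero and nonzero planar part; multiplication by a sign and negation
permute the nonzero ones. -/
theorem isCompl_range_index (ε : ℤˣ) :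
    IsCompl (Set.range fun k : ℤ => (((0, 0), k) : (ℤ × ℤ) × ℤ))
      (Set.range fun q : {κ : ℤ × ℤ // κ ≠ 0} × ℤ =>
        (((ε * q.1.1.1, ε * q.1.1.2), -q.2) : (ℤ × ℤ) × ℤ)) := by
  have hε : (ε : ℤ) * ε = 1 := Int.units_coe_mul_self ε
  have hε0 : (ε : ℤ) ≠ 0 := ε.ne_zero
  refine ⟨Set.disjoint_left.2 ?_, codisjoint_iff.2 (Set.eq_univ_of_forall ?_)⟩
  · rintro _ ⟨k, rfl⟩ ⟨⟨⟨⟨a, b⟩, h⟩, l⟩, e⟩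
    simp only [Prod.mk.injEq, mul_eq_zero, hε0, false_or] at e
    exact h (Prod.ext e.1.1 e.1.2)
  · rintro ⟨⟨a, b⟩, k⟩
    by_cases h : ((a, b) : ℤ × ℤ) = 0
    · left
      obtain ⟨rfl, rfl⟩ := Prod.mk.inj h
      exact ⟨k, rfl⟩
    · right
      refine ⟨(⟨(ε * a, ε * b), fun h' => h ?_⟩, -k), ?_⟩
      · obtain ⟨h1, h2⟩ := Prod.mk.inj h'
        exact Prod.ext ((mul_eq_zero.1 h1).resolve_left hε0) ((mul_eq_zero.1 h2).resolve_left hε0)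
      · simp only [← mul_assoc, hε, one_mul, neg_neg]

theorem index_injective (ε : ℤˣ) :
    Function.Injective fun q : {κ : ℤ × ℤ // κ ≠ 0} × ℤ =>
        (((ε * q.1.1.1, ε * q.1.1.2), -q.2) : (ℤ × ℤ) × ℤ) := by
  have hε0 : (ε : ℤ) ≠ 0 := ε.ne_zero
  rintro ⟨⟨⟨a, b⟩, h⟩, k⟩ ⟨⟨⟨a', b'⟩, h'⟩, k'⟩ e
  simp only [Prod.mk.injEq, neg_inj, mul_right_inj' hε0] at e
  obtain ⟨⟨rfl, rfl⟩, rfl⟩ := e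
  rfl

end SE2Fourier

open SE2Fourier
theorem mainTheorem3 (c : ℝ) (hc : 0 < c) (ε : ℤˣ)
    (μ : Measure CosetSpace) [IsFiniteMeasure μ] (hμ : IsNormalizedInvariant c μ)
    (f : SE2 → ℂ) (hf : Integrable f (haar c))
    (hf₂ : MemLp (periodize fun g => ‖f g‖) 2 μ) :
    ∃ hF : MemLp (periodize f) 2 μ,
      (∀ (κ : {κ : ℤ × ℤ // κ ≠ 0}) (k₃ : ℤ),
        Summable (fun n : ℤ => innerTerm ε c f κ k₃ n) (SummationFilter.conditional ℤ)) ∧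
      Summable (fun k : ℤ => charCoeff c f k • psiLp μ 0 0 k) ∧
      Summable (fun q : {κ : ℤ × ℤ // κ ≠ 0} × ℤ =>
        (∑'[SummationFilter.conditional ℤ] n : ℤ, innerTerm ε c f q.1 q.2 n) •
          psiLp μ (ε * q.1.1.1) (ε * q.1.1.2) (-q.2)) ∧
      ((2 * π * c : ℝ) : ℂ) • hF.toLp (periodize f) =
        (∑' k : ℤ, charCoeff c f k • psiLp μ 0 0 k) +
        ∑' κ : {κ : ℤ × ℤ // κ ≠ 0}, ∑' k₃ : ℤ,
          (∑'[SummationFilter.conditional ℤ] n : ℤ, innerTerm ε c f κ k₃ n) •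
            psiLp μ (ε * κ.1.1) (ε * κ.1.2) (-k₃) := by
  have hF := hμ.memLp_periodize hf hf₂
  set A : (ℤ × ℤ) × ℤ → Lp ℂ 2 μ := fun q =>
    (∫ g, f g * conj (basisLift q.1.1 q.1.2 q.2 g) ∂(haar c)) • psiLp μ q.1.1 q.1.2 q.2 with hA
  have hsum : HasSum A (((2 * π * c : ℝ) : ℂ) • hF.toLp (periodize f)) := by
    have h := finThreeEquiv.hasSum_iff.2 (hμ.hasSum_psiLp hc (hF.toLp _))
    refine h.congr_fun fun q => ?_
    rw [hA]
    simp only [Function.comp_apply]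
    rw [inner_psiLp, hμ.integral_periodize_mul_conj_psi hf]
    rfl
  have hinner : ∀ (κ : ℤ × ℤ) (k : ℤ), ∑'[SummationFilter.conditional ℤ] n : ℤ,
      innerTerm ε c f κ k n = ∫ g, f g * conj (basisLift (ε * κ.1) (ε * κ.2) (-k) g) ∂(haar c) :=
    fun κ k => (hasSum_innerTerm hf ε κ k).tsum_eq
  simp only [hinner, charCoeff_eq]
  have hinj₁ : Function.Injective fun k : ℤ => (((0, 0), k) : (ℤ × ℤ) × ℤ) := fun k l h => by
    simpa using h
  have s₁ := hsum.summable.comp_injective hinj₁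
  have s₂ := hsum.summable.comp_injective (index_injective ε)
  refine ⟨hF, fun κ k => (hasSum_innerTerm hf ε κ k).summable, s₁, s₂, ?_⟩
  have h := HasSum.add_isCompl (isCompl_range_index ε) (hinj₁.hasSum_range_iff.2 s₁.hasSum)
    ((index_injective ε).hasSum_range_iff.2 s₂.hasSum)
  -- Unconditional convergence over pairs permits the iterated sum.
  rw [hsum.unique h, s₂.tsum_prod]
  rfl
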